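/- Let $n,l$ be natural numbers, let $z_1,\dots,z_l\in\mathbb R^n$ be known source points and let $\alpha\in\mathbb R^l$ with $\sum_{i=1}^l\alpha_i=1$. A body moves in $\mathbb R^n$ according to $\dot x(t)=u(t)$, $t\ge 0$, where the measured (unbiased) velocity $u:[0,\infty)\to\mathbb R^n$ is continuous and bounded. The range measurements are $y_i=\tfrac12|x-z_i|^2$, $i=1,\dots,l$. Put $$y_0:=\sum_{i=1}^l\alpha_i\bigl(y_i-\tfrac12|z_i|^2\bigr),\qquad X:=\begin{bmatrix}x\\ y_0\end{bmatrix}\in\mathbb R^{n+1},\qquad y:=\bigl[y_0,\;y_1-y_0-\tfrac12|z_1|^2,\;\dots,\;y_l-y_0-\tfrac12|z_l|^2\bigr]^\top\in\mathbb R^{l+1},$$ $$Z:=[z_1\ \cdots\ z_l],\quad D(\alpha):=[1,\dots,1]^\top\alpha^\top-I_l,\quad A(t):=\begin{bmatrix}0&0\\u(t)^\top&0\end{bmatrix},\quad \bar u:=\begin{bmatrix}u\\-\sum_i\alpha_iz_i^\top u\end{bmatrix},\quad C:=\begin{bmatrix}0&1\\D(\alpha)Z^\top&0\end{bmatrix}.$$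 Consider the Riccati observer $$\dot{\hat X}=A(t)\hat X+\bar u+K(t)(y-C\hat X),\quad K(t)=k(t)P(t)C^\top Q(t),\quad \dot P=A(t)P+PA(t)^\top-PC^\top Q(t)CP+V(t),\quad P(0)=P_0,$$ where $P_0$ is symmetric positive definite, $k$ is continuous with $k(t)\ge\tfrac12$, and $Q,V$ are continuous, bounded, symmetric and bounded below by $\varepsilon I$ for some $\varepsilon>0$, on $[0,\infty)$. Say that the observer *globally exponentially stabilizes* $\tilde X:=X-\hat X$ at $0$ if it is well defined on $[0,\infty)$ (the Riccati equation has exactly one solution $P$ on $[0,\infty)$, $P(t)$ is positive definite for all $t\ge0$, and for every motion there is an observer trajectory from every initial estimate $\hat X(0)$), and there are $c,r>0$ such that for every motion $x$ with velocity $u$ and every observer trajectory $$|\tilde X(t)|\le c\,e^{-r(t-t_0)}|\tilde X(t_0)|\qquad\text{for all }t\ge t_0\ge 0.$$ 1. Suppose that $u$ is uniformly continuous on $[0,\infty)$ (for instance, that $u$ has a bounded derivative), and that for some $\delta>0$ and $\mu>0$ $$\forall t\ge0:\quad ZD^\top(\alpha)D(\alpha)Z^\top+\frac1\delta\int_t^{t+\delta}u(s)u^\top(s)\,ds\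 \ge\ \mu I_n .\tag{PE}$$ Then the Riccati observer globally exponentially stabilizes $\tilde X=0$. 2. If $\operatorname{rank}(D(\alpha)Z^\top)=n$, then there is $\mu>0$ such that (PE) holds, with this $\mu$, for every continuous velocity on $[0,\infty)$ and every $\delta>0$; moreover the Riccati observer globally exponentially stabilizes $\tilde X=0$ (here $u$ need not be uniformly continuous). 3. The condition $\operatorname{rank}(D(\alpha)Z^\top)=n$ holds as soon as $n+1$ of the source points are affinely independent. -/

import Mathlib

namespace RangeObserver

/-- Index type of the augmented state `X = (x, y₀)`, of dimension `n + 1`. -/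
abbrev StateIdx (n : ℕ) : Type := Fin n ⊕ Unit

/-- Index type of the output `y = (y₀, …)`, of dimension `l + 1`. -/
abbrev OutIdx (l : ℕ) : Type := Unit ⊕ Fin l

/-- The `n × l` matrix `Z = [z₁ … z_l]` whose columns are the source points. -/
def sourceMatrix {n l : ℕ} (z : Fin l → EuclideanSpace ℝ (Fin n)) :
    Matrix (Fin n) (Fin l) ℝ :=
  Matrix.of fun i j => z j i

/-- `D(α) = ξ αᵀ - I`, with `ξ = (1, …, 1)ᵀ`. -/
def weightMatrix {l : ℕ} (α : Fin l → ℝ) : Matrix (Fin l) (Fin l) ℝ :=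
  Matrix.vecMulVec (fun _ => 1) α - 1

/-- The state matrix `A = [0 0; uᵀ 0]` at a given value of the velocity. -/
def stateMatrix {n : ℕ} (u : EuclideanSpace ℝ (Fin n)) :
    Matrix (StateIdx n) (StateIdx n) ℝ :=
  Matrix.fromBlocks 0 0 (Matrix.of fun _ i => u i) 0

/-- The constant output matrix `C = [0 1; D(α)Zᵀ 0]`. -/
def outputMatrix {n l : ℕ} (z : Fin l → EuclideanSpace ℝ (Fin n)) (α : Fin l → ℝ) :
    Matrix (OutIdx l) (StateIdx n) ℝ :=
  Matrix.fromBlocks 0 (Matrix.of fun _ _ => 1) (weightMatrix α * (sourceMatrix z).transpose) 0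

/-- The input `ū = (u, -∑ αᵢ zᵢᵀu)`. -/
noncomputable def augmentedInput {n l : ℕ} (z : Fin l → EuclideanSpace ℝ (Fin n))
    (α : Fin l → ℝ) (u : EuclideanSpace ℝ (Fin n)) : StateIdx n → ℝ :=
  Sum.elim (fun i => u i) (fun _ => -∑ i, α i * inner ℝ (z i) u)

/-- The range measurement `yᵢ = |x - zᵢ|² / 2`. -/
noncomputable def rangeOutput {n l : ℕ} (z : Fin l → EuclideanSpace ℝ (Fin n))
    (x : EuclideanSpace ℝ (Fin n)) (i : Fin l) : ℝ :=
  (1 / 2) * ‖x - z i‖ ^ 2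

/-- The weighted output `y₀ = ∑ αᵢ (yᵢ - |zᵢ|² / 2)`. -/
noncomputable def weightedOutput {n l : ℕ} (z : Fin l → EuclideanSpace ℝ (Fin n))
    (α : Fin l → ℝ) (x : EuclideanSpace ℝ (Fin n)) : ℝ :=
  ∑ i, α i * (rangeOutput z x i - (1 / 2) * ‖z i‖ ^ 2)

/-- The measured output `y = (y₀, y₁ - y₀ - |z₁|² / 2, …, y_l - y₀ - |z_l|² / 2)`. -/
noncomputable def measuredOutput {n l : ℕ} (z : Fin l → EuclideanSpace ℝ (Fin n))
    (α : Fin l → ℝ) (x : EuclideanSpace ℝ (Fin n)) : OutIdx l → ℝ :=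
  Sum.elim (fun _ => weightedOutput z α x)
    (fun j => rangeOutput z x j - weightedOutput z α x - (1 / 2) * ‖z j‖ ^ 2)

/-- The augmented state `X = (x, y₀)`. -/
noncomputable def augmentedState {n l : ℕ} (z : Fin l → EuclideanSpace ℝ (Fin n))
    (α : Fin l → ℝ) (x : EuclideanSpace ℝ (Fin n)) : StateIdx n → ℝ :=
  Sum.elim (fun i => x i) (fun _ => weightedOutput z α x)

/-- `x` is a motion of the body on `[0, ∞)` with velocity `u`. -/
def IsMotion {n : ℕ} (u x : ℝ → EuclideanSpace ℝ (Fin n)) : Prop :=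
  ∀ t, 0 ≤ t → HasDerivWithinAt x (u t) (Set.Ici 0) t

/-- A continuous, bounded, symmetric matrix function on `[0, ∞)` with `ε I ≤ Q(t)` for some
`ε > 0` independent of `t`. -/
def IsAdmissibleWeight {ι : Type*} [Fintype ι] [DecidableEq ι] (Q : ℝ → Matrix ι ι ℝ) : Prop :=
  ContinuousOn Q (Set.Ici 0) ∧
    (∃ ε : ℝ, 0 < ε ∧ ∀ t, 0 ≤ t → (Q t - ε • (1 : Matrix ι ι ℝ)).PosSemidef) ∧
    (∃ c : ℝ, ∀ t, 0 ≤ t → (c • (1 : Matrix ι ι ℝ) - Q t).PosSemidef)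

/-- `P` solves, on all of `[0, ∞)`, the continuous Riccati equation
`Ṗ = A P + P Aᵀ - P Cᵀ Q C P + V`, `P(0) = P₀`. -/
def IsCRESolution {ι κ : Type*} [Fintype ι] [Fintype κ]
    (A : ℝ → Matrix ι ι ℝ) (C : Matrix κ ι ℝ) (Q : ℝ → Matrix κ κ ℝ) (V : ℝ → Matrix ι ι ℝ)
    (P₀ : Matrix ι ι ℝ) (P : ℝ → Matrix ι ι ℝ) : Prop :=
  P 0 = P₀ ∧ ∀ t, 0 ≤ t → ∀ i j,
    HasDerivWithinAt (fun s => P s i j)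
      ((A t * P t + P t * (A t).transpose - P t * C.transpose * Q t * C * P t + V t) i j)
      (Set.Ici 0) t

/-- `Xhat` is a trajectory on `[0, ∞)` of the observer
`dXhat/dt = A Xhat + ū + K (y - C Xhat)` with gain `K = k P Cᵀ Q`. -/
def IsObserverTrajectory {ι κ : Type*} [Fintype ι] [Fintype κ]
    (A : ℝ → Matrix ι ι ℝ) (C : Matrix κ ι ℝ) (ubar : ℝ → ι → ℝ) (y : ℝ → κ → ℝ)
    (k : ℝ → ℝ) (Q : ℝ → Matrix κ κ ℝ) (P : ℝ → Matrix ι ι ℝ) (Xhat : ℝ → ι → ℝ) : Prop :=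
  ∀ t, 0 ≤ t →
    HasDerivWithinAt Xhat
      ((A t).mulVec (Xhat t) + ubar t +
        (k t • (P t * C.transpose * Q t)).mulVec (y t - C.mulVec (Xhat t)))
      (Set.Ici 0) t

/-- A family of error trajectories on `[0, ∞)` decays globally and uniformly exponentially to
zero: the constants depend neither on the trajectory nor on the initial time. -/
def GloballyExponentiallyStable {ι : Type*} [Fintype ι] (E : Set (ℝ → ι → ℝ)) : Prop :=
  ∃ c r : ℝ, 0 < c ∧ 0 < r ∧ ∀ e ∈ E, ∀ t₀ t, 0 ≤ t₀ → t₀ ≤ t →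
    ‖WithLp.toLp 2 (e t)‖ ≤ c * Real.exp (-r * (t - t₀)) * ‖WithLp.toLp 2 (e t₀)‖

/-- The errors `X - Xhat` of the range observer, over all motions of velocity `u` (that is, all
initial positions) and all observer trajectories driven by the corresponding measurements. -/
def estimationErrors {n l : ℕ} (z : Fin l → EuclideanSpace ℝ (Fin n)) (α : Fin l → ℝ)
    (u : ℝ → EuclideanSpace ℝ (Fin n)) (k : ℝ → ℝ) (Q : ℝ → Matrix (OutIdx l) (OutIdx l) ℝ)
    (P : ℝ → Matrix (StateIdx n) (StateIdx n) ℝ) : Set (ℝ → StateIdx n → ℝ) :=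
  {e | ∃ (x : ℝ → EuclideanSpace ℝ (Fin n)) (Xhat : ℝ → StateIdx n → ℝ), IsMotion u x ∧
    IsObserverTrajectory (fun t => stateMatrix (u t)) (outputMatrix z α)
      (fun t => augmentedInput z α (u t)) (fun t => measuredOutput z α (x t)) k Q P Xhat ∧
    e = fun t => augmentedState z α (x t) - Xhat t}

/-- The Riccati observer with parameters `k, Q, V` and initial value `P₀` is well defined on
`[0, ∞)` (the Riccati equation has a unique solution, which is positive definite, and the observer
has a trajectory from every initial estimate) and it globally exponentially stabilizes the
estimation error `X - Xhat` at zero. -/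
def RiccatiObserverStabilizes {n l : ℕ} (z : Fin l → EuclideanSpace ℝ (Fin n)) (α : Fin l → ℝ)
    (u : ℝ → EuclideanSpace ℝ (Fin n)) (k : ℝ → ℝ) (Q : ℝ → Matrix (OutIdx l) (OutIdx l) ℝ)
    (V : ℝ → Matrix (StateIdx n) (StateIdx n) ℝ) (P₀ : Matrix (StateIdx n) (StateIdx n) ℝ) :
    Prop :=
  ∃ P : ℝ → Matrix (StateIdx n) (StateIdx n) ℝ,
    IsCRESolution (fun t => stateMatrix (u t)) (outputMatrix z α) Q V P₀ P ∧
    (∀ P', IsCRESolution (fun t => stateMatrix (u t)) (outputMatrix z α) Q V P₀ P' →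
      ∀ t, 0 ≤ t → P' t = P t) ∧
    (∀ t, 0 ≤ t → (P t).PosDef) ∧
    (∀ x, IsMotion u x → ∀ Xhat₀ : StateIdx n → ℝ, ∃ Xhat : ℝ → StateIdx n → ℝ,
      Xhat 0 = Xhat₀ ∧
      IsObserverTrajectory (fun t => stateMatrix (u t)) (outputMatrix z α)
        (fun t => augmentedInput z α (u t)) (fun t => measuredOutput z α (x t)) k Q P Xhat) ∧
    GloballyExponentiallyStable (estimationErrors z α u k Q P)

/-- `Z Dᵀ(α) D(α) Zᵀ + (1/δ) ∫_t^{t+δ} u(s) uᵀ(s) ds ≥ μ I` for all `t ≥ 0`. -/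
def PersistentlyExciting {n l : ℕ} (z : Fin l → EuclideanSpace ℝ (Fin n)) (α : Fin l → ℝ)
    (u : ℝ → EuclideanSpace ℝ (Fin n)) (δ μ : ℝ) : Prop :=
  ∀ t, 0 ≤ t →
    (sourceMatrix z * (weightMatrix α).transpose * weightMatrix α * (sourceMatrix z).transpose +
      (1 / δ) • (Matrix.of fun i j => ∫ s in t..(t + δ), u s i * u s j) -
      μ • (1 : Matrix (Fin n) (Fin n) ℝ)).PosSemidef

end RangeObserver

open Set Filter Topology Matrix
open scoped NNReal

namespace RangeObserver

section LinearODE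

variable {κ : Type*} [Fintype κ]

/-- Coordinatewise truncation to `[-R, R]`. -/
def clamp (R : ℝ) (x : κ → ℝ) : κ → ℝ := fun i => max (-R) (min R (x i))

lemma lipschitzWith_clamp (R : ℝ) : LipschitzWith 1 (clamp (κ := κ) R) := by
  refine LipschitzWith.of_dist_le_mul fun x y => ?_
  simp only [NNReal.coe_one, one_mul]
  refine (dist_pi_le_iff dist_nonneg).2 fun i => le_trans ?_ (dist_le_pi_dist x y i)
  simp only [clamp, Real.dist_eq]
  rw [max_comm (-R), max_comm (-R)]
  refine (abs_max_sub_max_le_abs _ _ _).trans ?_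
  simpa using abs_min_sub_min_le_max R (x i) R (y i)

lemma norm_clamp_le {R : ℝ} (hR : 0 ≤ R) (x : κ → ℝ) : ‖clamp R x‖ ≤ R := by
  refine (pi_norm_le_iff_of_nonneg hR).2 fun i => ?_
  rw [Real.norm_eq_abs, abs_le]
  exact ⟨le_max_left _ _, max_le (by linarith) (min_le_left _ _)⟩

lemma clamp_eq_self {R : ℝ} {x : κ → ℝ} (hx : ‖x‖ ≤ R) : clamp R x = x := by
  funext i
  have := abs_le.1 ((norm_le_pi_norm x i).trans hx)
  simp [clamp, this.1, this.2]

lemma norm_clamp_le_norm {R : ℝ} (hR : 0 ≤ R) (x : κ → ℝ) : ‖clamp R x‖ ≤ ‖x‖ := by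
  have h0 : clamp R (0 : κ → ℝ) = 0 := clamp_eq_self (by simpa using hR)
  simpa [h0] using (lipschitzWith_clamp R).dist_le_mul x 0

/-- A globally Lipschitz vector field has a solution on every compact interval. -/
theorem exists_solution_Icc {f : ℝ → (κ → ℝ) → κ → ℝ} {T : ℝ} (hT : 0 ≤ T)
    (hc : ∀ x, ContinuousOn (fun t => f t x) (Icc 0 T)) {K : ℝ≥0}
    (hL : ∀ t ∈ Icc 0 T, LipschitzWith K (f t)) (x₀ : κ → ℝ) :
    ∃ x : ℝ → κ → ℝ, x 0 = x₀ ∧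
      ∀ t ∈ Icc 0 T, HasDerivWithinAt x (f t (x t)) (Icc 0 T) t := by
  obtain ⟨b, hb⟩ := isCompact_Icc.exists_bound_of_continuousOn (hc 0)
  have hb0 : 0 ≤ b := (norm_nonneg _).trans (hb 0 ⟨le_rfl, hT⟩)
  have hgrow : ∀ t ∈ Icc 0 T, ∀ x, ‖f t x‖ ≤ K * ‖x‖ + b := fun t ht x => by
    have h1 := (hL t ht).dist_le_mul x 0
    rw [dist_eq_norm, dist_zero_right] at h1
    linarith [norm_le_norm_add_norm_sub' (f t x) (f t 0), hb t ht]
  set R : ℝ := gronwallBound ‖x₀‖ K b T with hR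
  have hR0 : ∀ t ∈ Icc 0 T, gronwallBound ‖x₀‖ K b t ≤ R := fun t ht =>
    gronwallBound_mono (norm_nonneg _) hb0 K.2 ht.2
  have hRx : ‖x₀‖ ≤ R := by simpa [gronwallBound_x0] using hR0 0 ⟨le_rfl, hT⟩
  have hRn : 0 ≤ R := (norm_nonneg _).trans hRx
  let L : ℝ≥0 := ⟨K * R + b, by positivity⟩
  let a : ℝ≥0 := L * T.toNNReal
  have hpl : IsPicardLindelof (fun t x => f t (clamp R x)) (⟨0, le_rfl, hT⟩ : Icc (0 : ℝ) T)
      x₀ a 0 L K := by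
    refine ⟨fun t ht => ?_, fun x _ => hc _, fun t ht x _ => ?_, ?_⟩
    · have := ((hL t ht).comp (lipschitzWith_clamp R)).lipschitzOnWith (s := Metric.closedBall x₀ a)
      rwa [mul_one] at this
    · refine (hgrow t ht _).trans ?_
      have := mul_le_mul_of_nonneg_left (norm_clamp_le hRn x) K.2
      exact add_le_add_left this b
    · simp [a, hT]
  obtain ⟨x, hx0, hx⟩ := hpl.exists_eq_forall_mem_Icc_hasDerivWithinAt₀
  have hbound : ∀ t ∈ Icc 0 T, ‖x t‖ ≤ gronwallBound ‖x₀‖ K b (t - 0) := by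
    refine norm_le_gronwallBound_of_norm_deriv_right_le
      (f' := fun t => f t (clamp R (x t)))
      (fun t ht => (hx t ht).continuousWithinAt) (fun t ht => ?_) (by rw [← hx0]) ?_
    · exact (hx t (Ico_subset_Icc_self ht)).mono_of_mem_nhdsWithin (Icc_mem_nhdsGE_of_mem ht)
    · intro t ht
      refine (hgrow t (Ico_subset_Icc_self ht) _).trans ?_
      have := mul_le_mul_of_nonneg_left (norm_clamp_le_norm hRn (x t)) K.2
      exact add_le_add_left this b
  refine ⟨x, hx0, fun t ht => ?_⟩
  have h := hx t ht
  have hb' := hbound t ht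
  rw [sub_zero] at hb'
  simpa only [clamp_eq_self (hb'.trans (hR0 t ht))] using h

/-- A vector field which is globally Lipschitz, locally uniformly in time, has a solution on
`[0, ∞)`. -/
theorem exists_solution_Ici {f : ℝ → (κ → ℝ) → κ → ℝ}
    (hc : ∀ x, ContinuousOn (fun t => f t x) (Ici 0))
    (hL : ∀ T : ℝ, ∃ K : ℝ≥0, ∀ t ∈ Icc 0 T, LipschitzWith K (f t)) (x₀ : κ → ℝ) :
    ∃ x : ℝ → κ → ℝ, x 0 = x₀ ∧ ∀ t, 0 ≤ t → HasDerivWithinAt x (f t (x t)) (Ici 0) t := by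
  have hex : ∀ N : ℕ, ∃ x : ℝ → κ → ℝ, x 0 = x₀ ∧
      ∀ t ∈ Icc (0 : ℝ) N, HasDerivWithinAt x (f t (x t)) (Icc 0 (N : ℝ)) t := fun N => by
    obtain ⟨K, hK⟩ := hL N
    exact exists_solution_Icc N.cast_nonneg (fun x => (hc x).mono Icc_subset_Ici_self) hK x₀
  choose x hx0 hx using hex
  have hagree : ∀ {M N : ℕ}, M ≤ N → EqOn (x M) (x N) (Icc 0 (M : ℝ)) := by
    intro M N hMN
    have hsub : Icc (0 : ℝ) M ⊆ Icc (0 : ℝ) N := Icc_subset_Icc_right (by exact_mod_cast hMN)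
    obtain ⟨K, hK⟩ := hL M
    refine ODE_solution_unique_of_mem_Icc_right (v := f) (s := fun _ => univ) (K := K)
      (fun t ht => (hK t (Ico_subset_Icc_self ht)).lipschitzOnWith)
      (fun t ht => (hx M t ht).continuousWithinAt) (fun t ht => ?_) (fun _ _ => mem_univ _)
      (fun t ht => ((hx N t (hsub ht)).mono hsub).continuousWithinAt) (fun t ht => ?_)
      (fun _ _ => mem_univ _) (by rw [hx0, hx0])
    · exact (hx M t (Ico_subset_Icc_self ht)).mono_of_mem_nhdsWithin (Icc_mem_nhdsGE_of_mem ht)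
    · exact ((hx N t (hsub (Ico_subset_Icc_self ht))).mono hsub).mono_of_mem_nhdsWithin
        (Icc_mem_nhdsGE_of_mem ht)
  have hval : ∀ (N : ℕ) (t : ℝ), t ∈ Icc (0 : ℝ) N → x ⌈t⌉₊ t = x N t := fun N t ht =>
    hagree (Nat.ceil_le.2 ht.2) ⟨ht.1, Nat.le_ceil t⟩
  refine ⟨fun t => x ⌈t⌉₊ t, by simp [hx0], fun t ht => ?_⟩
  obtain ⟨N, hN⟩ := exists_nat_gt t
  have hmem : Icc (0 : ℝ) N ∈ 𝓝[Ici 0] t := by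
    rw [← Ici_inter_Iic]
    exact inter_mem self_mem_nhdsWithin (mem_nhdsWithin_of_mem_nhds (Iic_mem_nhds hN))
  have h1 := (hx N t ⟨ht, hN.le⟩).mono_of_mem_nhdsWithin hmem
  have h2 : (fun t => x ⌈t⌉₊ t) =ᶠ[𝓝[Ici 0] t] x N := by
    filter_upwards [hmem] with s hs using hval N s hs
  simp only [hval N t ⟨ht, hN.le⟩]
  exact h1.congr_of_eventuallyEq h2 (hval N t ⟨ht, hN.le⟩)

/-- An affine system with continuous coefficients has a solution on `[0, ∞)`. -/
theorem exists_affine_solution {M : ℝ → Matrix κ κ ℝ} {b : ℝ → κ → ℝ}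
    (hM : ContinuousOn M (Ici 0)) (hb : ContinuousOn b (Ici 0)) (x₀ : κ → ℝ) :
    ∃ x : ℝ → κ → ℝ, x 0 = x₀ ∧
      ∀ t, 0 ≤ t → HasDerivWithinAt x (M t *ᵥ x t + b t) (Ici 0) t := by
  classical
  refine exists_solution_Ici (f := fun t x => M t *ᵥ x + b t) (fun x => ?_) (fun T => ?_) x₀
  · exact ((continuous_fst.matrix_mulVec continuous_snd).comp_continuousOn
      (hM.prodMk continuousOn_const)).add hb
  · let _ : NormedAddCommGroup (Matrix κ κ ℝ) := Matrix.linftyOpNormedAddCommGroup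
    obtain ⟨c, hc⟩ := isCompact_Icc.exists_bound_of_continuousOn
      (hM.mono (Icc_subset_Ici_self : Icc 0 T ⊆ Ici 0))
    refine ⟨c.toNNReal, fun t ht => LipschitzWith.of_dist_le_mul fun x y => ?_⟩
    rw [dist_add_right, dist_eq_norm, dist_eq_norm, ← Matrix.mulVec_sub]
    refine (Matrix.linfty_opNorm_mulVec _ _).trans ?_
    gcongr
    exact (hc t ht).trans (Real.le_coe_toNNReal c)

end LinearODE

section EntryDeriv

variable {m n p : Type*} {s : Set ℝ} {t : ℝ}

/-- Entrywise derivative of a matrix function within a set. -/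
def HasEntryDeriv (M : ℝ → Matrix m n ℝ) (M' : Matrix m n ℝ) (s : Set ℝ) (t : ℝ) : Prop :=
  ∀ i j, HasDerivWithinAt (fun τ => M τ i j) (M' i j) s t

lemma HasEntryDeriv.transpose {M : ℝ → Matrix m n ℝ} {M' : Matrix m n ℝ}
    (h : HasEntryDeriv M M' s t) : HasEntryDeriv (fun τ => (M τ)ᵀ) M'ᵀ s t :=
  fun i j => h j i

lemma HasEntryDeriv.mono {M : ℝ → Matrix m n ℝ} {M' : Matrix m n ℝ} {r : Set ℝ}
    (h : HasEntryDeriv M M' s t) (hr : r ⊆ s) : HasEntryDeriv M M' r t :=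
  fun i j => (h i j).mono hr

lemma HasEntryDeriv.sub {M N : ℝ → Matrix m n ℝ} {M' N' : Matrix m n ℝ}
    (hM : HasEntryDeriv M M' s t) (hN : HasEntryDeriv N N' s t) :
    HasEntryDeriv (fun τ => M τ - N τ) (M' - N') s t :=
  fun i j => (hM i j).sub (hN i j)

lemma HasEntryDeriv.mul [Fintype n] {M : ℝ → Matrix m n ℝ} {M' : Matrix m n ℝ}
    {N : ℝ → Matrix n p ℝ} {N' : Matrix n p ℝ}
    (hM : HasEntryDeriv M M' s t) (hN : HasEntryDeriv N N' s t) :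
    HasEntryDeriv (fun τ => M τ * N τ) (M' * N t + M t * N') s t := by
  intro i j
  simp only [Matrix.mul_apply, Matrix.add_apply, ← Finset.sum_add_distrib]
  exact HasDerivWithinAt.fun_sum fun k _ => (hM i k).mul (hN k j)

lemma hasDerivWithinAt_dotProduct [Fintype n] {v w : ℝ → n → ℝ} {v' w' : n → ℝ}
    (hv : HasDerivWithinAt v v' s t) (hw : HasDerivWithinAt w w' s t) :
    HasDerivWithinAt (fun τ => v τ ⬝ᵥ w τ) (v' ⬝ᵥ w t + v t ⬝ᵥ w') s t := by
  simp only [dotProduct, ← Finset.sum_add_distrib]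
  exact HasDerivWithinAt.fun_sum fun k _ =>
    (hasDerivWithinAt_pi.1 hv k).mul (hasDerivWithinAt_pi.1 hw k)

lemma HasEntryDeriv.mulVec [Fintype m] [Fintype n] {M : ℝ → Matrix m n ℝ} {M' : Matrix m n ℝ}
    {v : ℝ → n → ℝ} {v' : n → ℝ}
    (hM : HasEntryDeriv M M' s t) (hv : HasDerivWithinAt v v' s t) :
    HasDerivWithinAt (fun τ => M τ *ᵥ v τ) (M' *ᵥ v t + M t *ᵥ v') s t :=
  hasDerivWithinAt_pi.2 fun i =>
    hasDerivWithinAt_dotProduct (hasDerivWithinAt_pi.2 fun j => hM i j) hv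

lemma HasEntryDeriv.continuousWithinAt {M : ℝ → Matrix m n ℝ} {M' : Matrix m n ℝ}
    (h : HasEntryDeriv M M' s t) : ContinuousWithinAt M s t :=
  continuousWithinAt_pi.2 fun i => continuousWithinAt_pi.2 fun j => (h i j).continuousWithinAt

lemma continuousWithinAt_matrix_inv [Fintype n] [DecidableEq n] {M : ℝ → Matrix n n ℝ}
    (h : ContinuousWithinAt M s t) (hu : (M t).det ≠ 0) :
    ContinuousWithinAt (fun τ => (M τ)⁻¹) s t := by
  simp only [Matrix.inv_def, Ring.inverse_eq_inv]
  have h1 : ContinuousWithinAt (fun τ => (M τ).det) s t :=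
    (Continuous.matrix_det continuous_id).continuousAt.comp_continuousWithinAt h
  exact (h1.inv₀ hu).smul
    ((Continuous.matrix_adjugate continuous_id).continuousAt.comp_continuousWithinAt h)

lemma HasEntryDeriv.inv [Fintype n] [DecidableEq n] {M : ℝ → Matrix n n ℝ} {M' : Matrix n n ℝ}
    (h : HasEntryDeriv M M' s t) (hu : ∀ τ ∈ s, (M τ).det ≠ 0) (ht : t ∈ s) :
    HasEntryDeriv (fun τ => (M τ)⁻¹) (-((M t)⁻¹ * M' * (M t)⁻¹)) s t := by
  have hinv := continuousWithinAt_matrix_inv h.continuousWithinAt (hu t ht)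
  have hslope : Tendsto (fun τ => (τ - t)⁻¹ • (M τ - M t)) (𝓝[s \ {t}] t) (𝓝 M') := by
    refine tendsto_pi_nhds.2 fun i => tendsto_pi_nhds.2 fun j => ?_
    simpa [slope_fun_def] using hasDerivWithinAt_iff_tendsto_slope.1 (h i j)
  have hmul : Tendsto (fun τ => -((M τ)⁻¹ * ((τ - t)⁻¹ • (M τ - M t)) * (M t)⁻¹))
      (𝓝[s \ {t}] t) (𝓝 (-((M t)⁻¹ * M' * (M t)⁻¹))) := by
    have h0 : Tendsto (fun τ => (M τ)⁻¹) (𝓝[s \ {t}] t) (𝓝 (M t)⁻¹) :=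
      hinv.mono_left (nhdsWithin_mono _ sdiff_subset)
    exact ((h0.mul hslope).mul tendsto_const_nhds).neg
  intro i j
  refine hasDerivWithinAt_iff_tendsto_slope.2 ?_
  have hij := tendsto_pi_nhds.1 (tendsto_pi_nhds.1 hmul i) j
  refine hij.congr' ?_
  filter_upwards [self_mem_nhdsWithin] with τ hτ
  have h1 : (M τ)⁻¹ * M τ = 1 := Matrix.nonsing_inv_mul _ (hu τ hτ.1).isUnit
  have h2 : M t * (M t)⁻¹ = 1 := Matrix.mul_nonsing_inv _ (hu t ht).isUnit
  have h3 : -((M τ)⁻¹ * ((τ - t)⁻¹ • (M τ - M t)) * (M t)⁻¹)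
      = (τ - t)⁻¹ • ((M τ)⁻¹ - (M t)⁻¹) := by
    rw [Matrix.mul_smul, Matrix.smul_mul, Matrix.mul_sub, h1, Matrix.sub_mul, Matrix.one_mul,
      Matrix.mul_assoc, h2, Matrix.mul_one, ← smul_neg, neg_sub]
  rw [h3]
  simp [slope_def_field, div_eq_inv_mul]

end EntryDeriv

lemma monotoneOn_Ici_of_hasDerivWithinAt {f f' : ℝ → ℝ}
    (h : ∀ t, 0 ≤ t → HasDerivWithinAt f (f' t) (Ici 0) t) (hf' : ∀ t, 0 ≤ t → 0 ≤ f' t) :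
    MonotoneOn f (Ici 0) := by
  refine monotoneOn_of_hasDerivWithinAt_nonneg (convex_Ici 0) (f' := f')
    (fun t ht => (h t ht).continuousWithinAt) (fun t ht => ?_) (fun t ht => ?_)
  · exact (h t (interior_subset ht)).mono interior_subset
  · exact hf' t (interior_subset ht)

section Riccati

variable {ι κ : Type*} [Fintype ι] [Fintype κ] [DecidableEq ι]

/-- The linear Hamiltonian system associated with a Riccati equation has a solution on
`[0, ∞)`. -/
theorem exists_hamiltonian_solution {A R V : ℝ → Matrix ι ι ℝ} (hA : ContinuousOn A (Ici 0))
    (hR : ContinuousOn R (Ici 0)) (hV : ContinuousOn V (Ici 0)) (P₀ : Matrix ι ι ℝ) :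
    ∃ X Y : ℝ → Matrix ι ι ℝ, X 0 = 1 ∧ Y 0 = P₀ ∧
      (∀ t, 0 ≤ t → HasEntryDeriv X (-(A t)ᵀ * X t + R t * Y t) (Ici 0) t) ∧
      ∀ t, 0 ≤ t → HasEntryDeriv Y (V t * X t + A t * Y t) (Ici 0) t := by
  have hH : ContinuousOn (fun t => Matrix.fromBlocks (-(A t)ᵀ) (R t) (V t) (A t)) (Ici 0) := by
    intro t ht
    refine continuousWithinAt_pi.2 fun i => continuousWithinAt_pi.2 fun j => ?_
    have entry : ∀ {M : ℝ → Matrix ι ι ℝ}, ContinuousOn M (Ici 0) → ∀ i j,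
        ContinuousWithinAt (fun t => M t i j) (Ici 0) t := fun hM i j =>
      continuousWithinAt_pi.1 (continuousWithinAt_pi.1 (hM t ht) i) j
    rcases i with i | i <;> rcases j with j | j
    · exact (entry hA j i).neg
    · exact entry hR i j
    · exact entry hV i j
    · exact entry hA i j
  have hex := fun j : ι => exists_affine_solution hH (b := fun _ => 0) continuousOn_const
    (Sum.elim (fun i => (1 : Matrix ι ι ℝ) i j) (fun i => P₀ i j))
  choose v hv0 hv using hex
  refine ⟨fun t => Matrix.of fun i j => v j t (Sum.inl i),
    fun t => Matrix.of fun i j => v j t (Sum.inr i), ?_, ?_, fun t ht i j => ?_,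
    fun t ht i j => ?_⟩
  · ext i j; simp [hv0]
  · ext i j; simp [hv0]
  · refine (hasDerivWithinAt_pi.1 (hv j t ht) (Sum.inl i)).congr_deriv ?_
    simp [Matrix.mulVec, dotProduct, Matrix.mul_apply]
  · refine (hasDerivWithinAt_pi.1 (hv j t ht) (Sum.inr i)).congr_deriv ?_
    simp [Matrix.mulVec, dotProduct, Matrix.mul_apply]

/-- A Riccati equation with continuous coefficients, positive semidefinite `Q` and `V` and positive
definite initial value has a positive definite solution on `[0, ∞)`. -/
theorem exists_isCRESolution_posDef {A : ℝ → Matrix ι ι ℝ} {C : Matrix κ ι ℝ}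
    {Q : ℝ → Matrix κ κ ℝ} {V : ℝ → Matrix ι ι ℝ} {P₀ : Matrix ι ι ℝ}
    (hA : ContinuousOn A (Ici 0)) (hQ : ContinuousOn Q (Ici 0)) (hV : ContinuousOn V (Ici 0))
    (hQ' : ∀ t, 0 ≤ t → (Q t).PosSemidef) (hV' : ∀ t, 0 ≤ t → (V t).PosSemidef)
    (hP₀ : P₀.PosDef) :
    ∃ P, IsCRESolution A C Q V P₀ P ∧ ∀ t, 0 ≤ t → (P t).PosDef := by
  obtain ⟨R, hRdef⟩ : ∃ R : ℝ → Matrix ι ι ℝ, ∀ t, R t = Cᵀ * Q t * C := ⟨_, fun _ => rfl⟩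
  have hR : ContinuousOn R (Ici 0) :=
    (((continuous_const.matrix_mul continuous_id).matrix_mul
      continuous_const).comp_continuousOn hQ).congr fun t _ => hRdef t
  have hR' : ∀ t, 0 ≤ t → (R t).PosSemidef := fun t ht =>
    hRdef t ▸ (hQ' t ht).conjTranspose_mul_mul_same C
  obtain ⟨X, Y, hX0, hY0, hX, hY⟩ := exists_hamiltonian_solution hA hR hV P₀
  have hW : ∀ t, 0 ≤ t → HasEntryDeriv (fun t => (X t)ᵀ * Y t)
      ((Y t)ᵀ * R t * Y t + (X t)ᵀ * V t * X t) (Ici 0) t := fun t ht => by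
    have hRs : (R t)ᵀ = R t := (hR' t ht).1
    convert (hX t ht).transpose.mul (hY t ht) using 1
    simp only [Matrix.transpose_add, Matrix.transpose_mul, Matrix.transpose_neg,
      Matrix.transpose_transpose, hRs]
    noncomm_ring
  have hsymm : ∀ t, 0 ≤ t → ((X t)ᵀ * Y t).IsHermitian := by
    intro t ht
    have hd : ∀ t, 0 ≤ t → HasEntryDeriv (fun t => (X t)ᵀ * Y t - ((X t)ᵀ * Y t)ᵀ) 0 (Ici 0) t := by
      intro t ht
      have hRs : (R t)ᵀ = R t := (hR' t ht).1
      have hVs : (V t)ᵀ = V t := (hV' t ht).1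
      convert (hW t ht).sub (hW t ht).transpose using 1
      simp only [Matrix.transpose_add, Matrix.transpose_mul, Matrix.transpose_transpose, hRs, hVs,
        Matrix.mul_assoc, sub_self]
    have hge : ∀ i j, 0 ≤ ((X t)ᵀ * Y t - ((X t)ᵀ * Y t)ᵀ) i j := fun i j => by
      have := monotoneOn_Ici_of_hasDerivWithinAt (fun t ht => hd t ht i j) (fun _ _ => le_rfl)
        self_mem_Ici ht ht
      have hP : P₀ᵀ = P₀ := hP₀.1
      simpa [hX0, hY0, hP] using this
    ext i j
    have h1 := hge i j
    have h2 := hge j i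
    simp only [Matrix.sub_apply, Matrix.transpose_apply, sub_nonneg] at h1 h2
    exact le_antisymm h1 h2
  have hpos : ∀ t, 0 ≤ t → ((X t)ᵀ * Y t).PosDef := by
    intro t ht
    refine Matrix.PosDef.of_dotProduct_mulVec_pos (hsymm t ht) fun {v} hv => ?_
    have hd : ∀ t, 0 ≤ t → HasDerivWithinAt (fun t => v ⬝ᵥ ((X t)ᵀ * Y t) *ᵥ v)
        (v ⬝ᵥ ((Y t)ᵀ * R t * Y t + (X t)ᵀ * V t * X t) *ᵥ v) (Ici 0) t := fun t ht => by
      simpa using hasDerivWithinAt_dotProduct (hasDerivWithinAt_const t (Ici 0) v)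
        ((hW t ht).mulVec (hasDerivWithinAt_const t (Ici 0) v))
    have hmono := monotoneOn_Ici_of_hasDerivWithinAt hd (fun t ht =>
      (((hR' t ht).conjTranspose_mul_mul_same (Y t)).add
        ((hV' t ht).conjTranspose_mul_mul_same (X t))).dotProduct_mulVec_nonneg v)
      self_mem_Ici ht ht
    have h0 := hP₀.dotProduct_mulVec_pos hv
    simp only [hX0, hY0, Matrix.transpose_one, Matrix.one_mul] at hmono
    exact h0.trans_le hmono
  have hdet : ∀ t, 0 ≤ t → (X t).det ≠ 0 := fun t ht h => by
    have := (hpos t ht).det_pos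
    simp [h] at this
  refine ⟨fun t => Y t * (X t)⁻¹, ⟨by simp [hX0, hY0], fun t ht => ?_⟩, fun t ht => ?_⟩
  · have hd := (hY t ht).mul ((hX t ht).inv (fun τ hτ => hdet τ hτ) ht)
    have h1 : X t * (X t)⁻¹ = 1 := Matrix.mul_nonsing_inv _ (hdet t ht).isUnit
    have h2 : (V t * X t + A t * Y t) * (X t)⁻¹ + Y t * -((X t)⁻¹ * (-(A t)ᵀ * X t +
        R t * Y t) * (X t)⁻¹) = A t * (Y t * (X t)⁻¹) + Y t * (X t)⁻¹ * (A t)ᵀ -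
          Y t * (X t)⁻¹ * Cᵀ * Q t * C * (Y t * (X t)⁻¹) + V t := by
      simp only [hRdef, Matrix.add_mul, Matrix.mul_add, Matrix.mul_assoc, h1, Matrix.mul_neg,
        Matrix.neg_mul, Matrix.mul_one]
      abel
    rw [h2] at hd
    exact hd
  · have h1 : X t * (X t)⁻¹ = 1 := Matrix.mul_nonsing_inv _ (hdet t ht).isUnit
    have h2 : Y t * (X t)⁻¹ = ((X t)⁻¹)ᴴ * ((X t)ᵀ * Y t) * (X t)⁻¹ := by
      rw [Matrix.conjTranspose_eq_transpose_of_trivial, ← Matrix.mul_assoc,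
        ← Matrix.transpose_mul, h1, Matrix.transpose_one, Matrix.one_mul]
    show (Y t * (X t)⁻¹).PosDef
    rw [h2]
    refine (hpos t ht).conjTranspose_mul_mul_same ?_
    refine Function.LeftInverse.injective (g := fun v => X t *ᵥ v) fun v => ?_
    simp only [Matrix.mulVec_mulVec, h1, Matrix.one_mulVec]

/-- Solutions of the Riccati equation are unique. -/
theorem IsCRESolution.unique {A : ℝ → Matrix ι ι ℝ} {C : Matrix κ ι ℝ}
    {Q : ℝ → Matrix κ κ ℝ} {V : ℝ → Matrix ι ι ℝ} {P₀ : Matrix ι ι ℝ} {P P' : ℝ → Matrix ι ι ℝ}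
    (hA : ContinuousOn A (Ici 0)) (hQ : ContinuousOn Q (Ici 0))
    (hP : IsCRESolution A C Q V P₀ P) (hP' : IsCRESolution A C Q V P₀ P') :
    ∀ t, 0 ≤ t → P' t = P t := by
  let _ : NormedRing (Matrix ι ι ℝ) := Matrix.linftyOpNormedRing
  let _ : NormedAlgebra ℝ (Matrix ι ι ℝ) := Matrix.linftyOpNormedAlgebra
  intro T hT
  have hR : ContinuousOn (fun t => Cᵀ * Q t * C) (Ici 0) :=
    ((continuous_const.matrix_mul continuous_id).matrix_mul
      continuous_const).comp_continuousOn hQ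
  set R := fun t => Cᵀ * Q t * C with hRdef
  have hPd : ∀ t, 0 ≤ t → HasEntryDeriv P _ (Ici 0) t := hP.2
  have hPd' : ∀ t, 0 ≤ t → HasEntryDeriv P' _ (Ici 0) t := hP'.2
  have hPc : ContinuousOn P (Ici 0) := fun t ht => (hPd t ht).continuousWithinAt
  have hPc' : ContinuousOn P' (Ici 0) := fun t ht => (hPd' t ht).continuousWithinAt
  have hc1 : ContinuousOn (fun t => A t - P t * R t) (Icc 0 T) :=
    (hA.sub (hPc.mul hR)).mono Icc_subset_Ici_self
  have hc2 : ContinuousOn (fun t => (A t)ᵀ - R t * P' t) (Icc 0 T) :=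
    (((continuous_id.matrix_transpose).comp_continuousOn hA).sub (hR.mul hPc')).mono
      Icc_subset_Ici_self
  obtain ⟨k₁, hk₁⟩ := isCompact_Icc.exists_bound_of_continuousOn hc1
  obtain ⟨k₂, hk₂⟩ := isCompact_Icc.exists_bound_of_continuousOn hc2
  have hD : ∀ t, 0 ≤ t → HasDerivWithinAt (fun t => P' t - P t)
      ((A t - P t * R t) * (P' t - P t) + (P' t - P t) * ((A t)ᵀ - R t * P' t)) (Ici 0) t := by
    intro t ht
    have h := (hPd' t ht).sub (hPd t ht)
    have heq : A t * P' t + P' t * (A t)ᵀ - P' t * Cᵀ * Q t * C * P' t + V t -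
        (A t * P t + P t * (A t)ᵀ - P t * Cᵀ * Q t * C * P t + V t) =
        (A t - P t * R t) * (P' t - P t) + (P' t - P t) * ((A t)ᵀ - R t * P' t) := by
      simp only [hRdef]
      simp only [Matrix.mul_sub, Matrix.sub_mul, Matrix.mul_assoc]
      abel
    rw [heq] at h
    exact hasDerivWithinAt_pi.2 fun i => hasDerivWithinAt_pi.2 fun j => h i j
  have := eq_zero_of_abs_deriv_le_mul_abs_self_of_eq_zero_right (K := k₁ + k₂)
    (f := fun t => P' t - P t) (a := 0) (b := T)
    (fun t ht => ((hD t ht.1).mono Icc_subset_Ici_self).continuousWithinAt)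
    (fun t ht => (hD t ht.1).mono (Ici_subset_Ici.2 ht.1))
    (by simp [hP.1, hP'.1]) (fun t ht => ?_) T ⟨hT, le_rfl⟩
  · exact sub_eq_zero.1 this
  · refine (norm_add_le _ _).trans ?_
    have h1 := norm_mul_le (A t - P t * R t) (P' t - P t)
    have h2 := norm_mul_le (P' t - P t) ((A t)ᵀ - R t * P' t)
    have h3 := mul_le_mul_of_nonneg_right (hk₁ t (Ico_subset_Icc_self ht))
      (norm_nonneg (P' t - P t))
    have h4 := mul_le_mul_of_nonneg_right (hk₂ t (Ico_subset_Icc_self ht))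
      (norm_nonneg (P' t - P t))
    linarith

/-- The inverse of a positive definite solution of a Riccati equation solves the dual Riccati
equation. -/
theorem IsCRESolution.inv {A : ℝ → Matrix ι ι ℝ} {C : Matrix κ ι ℝ}
    {Q : ℝ → Matrix κ κ ℝ} {V : ℝ → Matrix ι ι ℝ} {P₀ : Matrix ι ι ℝ} {P : ℝ → Matrix ι ι ℝ}
    (hP : IsCRESolution A C Q V P₀ P) (hpos : ∀ t, 0 ≤ t → (P t).PosDef) :
    IsCRESolution (fun t => -(A t)ᵀ) (1 : Matrix ι ι ℝ) V (fun t => Cᵀ * Q t * C) P₀⁻¹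
      (fun t => (P t)⁻¹) := by
  refine ⟨by simp [hP.1], fun t ht => ?_⟩
  have hd : HasEntryDeriv P _ (Ici 0) t := hP.2 t ht
  have hdet : ∀ t, 0 ≤ t → (P t).det ≠ 0 := fun t ht => (hpos t ht).det_pos.ne'
  have h := hd.inv (fun τ hτ => hdet τ hτ) ht
  have h1 : P t * (P t)⁻¹ = 1 := Matrix.mul_nonsing_inv _ (hdet t ht).isUnit
  have h2 : (P t)⁻¹ * P t = 1 := Matrix.nonsing_inv_mul _ (hdet t ht).isUnit
  have h3 : ∀ M : Matrix ι ι ℝ, (P t)⁻¹ * (P t * M) = M := fun M => by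
    rw [← Matrix.mul_assoc, h2, Matrix.one_mul]
  have h4 : -((P t)⁻¹ * (A t * P t + P t * (A t)ᵀ - P t * Cᵀ * Q t * C * P t + V t) * (P t)⁻¹)
      = -(A t)ᵀ * (P t)⁻¹ + (P t)⁻¹ * (-(A t)ᵀ)ᵀ - (P t)⁻¹ * (1 : Matrix ι ι ℝ)ᵀ * V t *
        (1 : Matrix ι ι ℝ) * (P t)⁻¹ + Cᵀ * Q t * C := by
    simp only [Matrix.add_mul, Matrix.mul_add, Matrix.sub_mul, Matrix.mul_sub, Matrix.mul_assoc,
      h1, h3, Matrix.neg_mul, Matrix.mul_neg, Matrix.mul_one, Matrix.transpose_neg,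
      Matrix.transpose_transpose, Matrix.transpose_one]
    abel
  rw [h4] at h
  exact h

end Riccati

section Forms

variable {m n : Type*} [Fintype m] [Fintype n]

lemma dotProduct_transpose_mulVec (M : Matrix m n ℝ) (x : n → ℝ) (y : m → ℝ) :
    x ⬝ᵥ (Mᵀ *ᵥ y) = (M *ᵥ x) ⬝ᵥ y := by
  rw [Matrix.dotProduct_mulVec, Matrix.vecMul_transpose]

lemma dotProduct_mulVec_comm_of_symm {M : Matrix n n ℝ} (hM : Mᵀ = M) (x y : n → ℝ) :
    x ⬝ᵥ (M *ᵥ y) = y ⬝ᵥ (M *ᵥ x) := by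
  conv_lhs => rw [← hM]
  rw [dotProduct_transpose_mulVec, dotProduct_comm]

lemma two_mul_dotProduct_sub_le {ε : ℝ} (hε : 0 < ε) (x y : n → ℝ) :
    2 * (x ⬝ᵥ y) - ε * (y ⬝ᵥ y) ≤ (x ⬝ᵥ x) / ε := by
  have h := dotProduct_self_star_nonneg (x - ε • y)
  simp only [star_trivial, sub_dotProduct, dotProduct_sub, smul_dotProduct, dotProduct_smul,
    smul_eq_mul, dotProduct_comm y x] at h
  rw [le_div_iff₀ hε]
  nlinarith

lemma dotProduct_self_nonneg' (x : n → ℝ) : 0 ≤ x ⬝ᵥ x := by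
  simpa using dotProduct_self_star_nonneg x

lemma le_form_of_posSemidef [DecidableEq n] {M : Matrix n n ℝ} {ε : ℝ}
    (h : (M - ε • (1 : Matrix n n ℝ)).PosSemidef) (x : n → ℝ) :
    ε * (x ⬝ᵥ x) ≤ x ⬝ᵥ (M *ᵥ x) := by
  have := h.dotProduct_mulVec_nonneg x
  simp only [star_trivial, Matrix.sub_mulVec, Matrix.smul_mulVec, Matrix.one_mulVec,
    dotProduct_sub, dotProduct_smul, smul_eq_mul] at this
  linarith

lemma form_le_of_posSemidef [DecidableEq n] {M : Matrix n n ℝ} {c : ℝ}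
    (h : (c • (1 : Matrix n n ℝ) - M).PosSemidef) (x : n → ℝ) :
    x ⬝ᵥ (M *ᵥ x) ≤ c * (x ⬝ᵥ x) := by
  have := h.dotProduct_mulVec_nonneg x
  simp only [star_trivial, Matrix.sub_mulVec, Matrix.smul_mulVec, Matrix.one_mulVec,
    dotProduct_sub, dotProduct_smul, smul_eq_mul] at this
  linarith

lemma form_le_of_abs_entry_le {M : Matrix n n ℝ} {b : ℝ} (h : ∀ i j, |M i j| ≤ b) (x : n → ℝ) :
    x ⬝ᵥ (M *ᵥ x) ≤ b * Fintype.card n * (x ⬝ᵥ x) := by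
  have h1 : x ⬝ᵥ (M *ᵥ x) ≤ ∑ i, ∑ j, b * ((x i ^ 2 + x j ^ 2) / 2) := by
    simp only [dotProduct, Matrix.mulVec, Finset.mul_sum]
    refine Finset.sum_le_sum fun i _ => Finset.sum_le_sum fun j _ => ?_
    have h2 : x i * (M i j * x j) ≤ |M i j| * (|x i| * |x j|) := by
      rw [← abs_mul, ← abs_mul]
      exact (le_of_eq (by ring)).trans (le_abs_self _)
    refine h2.trans (mul_le_mul (h i j) ?_ (by positivity) ((abs_nonneg _).trans (h i j)))
    nlinarith [sq_nonneg (|x i| - |x j|), sq_abs (x i), sq_abs (x j)]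
  refine h1.trans (le_of_eq ?_)
  simp only [← Finset.mul_sum, ← Finset.sum_div, Finset.sum_add_distrib, Finset.sum_const,
    Finset.card_univ, nsmul_eq_mul, dotProduct, ← pow_two]
  ring

lemma exists_form_le_on_Icc {M : ℝ → Matrix n n ℝ} {a b : ℝ} (hM : ContinuousOn M (Icc a b)) :
    ∃ c, 0 ≤ c ∧ ∀ t ∈ Icc a b, ∀ x : n → ℝ, x ⬝ᵥ (M t *ᵥ x) ≤ c * (x ⬝ᵥ x) := by
  have hentry : ∀ p : n × n, ∃ c, ∀ t ∈ Icc a b, |M t p.1 p.2| ≤ c := fun p =>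
    isCompact_Icc.exists_bound_of_continuousOn
      (continuousOn_pi.1 (continuousOn_pi.1 hM p.1) p.2)
  choose c hc using hentry
  have hb : ∀ p, c p ≤ ∑ q, |c q| := fun p =>
    (le_abs_self _).trans
      (Finset.single_le_sum (f := fun q => |c q|) (fun _ _ => abs_nonneg _) (Finset.mem_univ p))
  refine ⟨(∑ q, |c q|) * Fintype.card n, by positivity, fun t ht x => ?_⟩
  exact form_le_of_abs_entry_le (fun i j => (hc (i, j) t ht).trans (hb (i, j))) x

lemma exists_mulVec_dotProduct_le (M : Matrix m n ℝ) :
    ∃ c, 0 ≤ c ∧ ∀ x : n → ℝ, (M *ᵥ x) ⬝ᵥ (M *ᵥ x) ≤ c * (x ⬝ᵥ x) := by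
  obtain ⟨c, hc0, hc⟩ := exists_form_le_on_Icc (M := fun _ => Mᵀ * M) (a := 0) (b := 0)
    continuousOn_const
  refine ⟨c, hc0, fun x => ?_⟩
  have := hc 0 ⟨le_rfl, le_rfl⟩ x
  rwa [← Matrix.mulVec_mulVec, dotProduct_transpose_mulVec] at this

end Forms

section RiccatiBound

variable {ι κ : Type*} [Fintype ι] [Fintype κ]

/-- The quadratic form of a Riccati solution is bounded by the cost of any control which steers the
adjoint system `ẇ = -Aᵀ w + Cᵀ η` from zero. -/
theorem IsCRESolution.form_le_of_control {A : ℝ → Matrix ι ι ℝ} {C : Matrix κ ι ℝ}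
    {Q : ℝ → Matrix κ κ ℝ} {V : ℝ → Matrix ι ι ℝ} {P₀ : Matrix ι ι ℝ} {P : ℝ → Matrix ι ι ℝ}
    (hP : IsCRESolution A C Q V P₀ P) (hsymm : ∀ t, 0 ≤ t → (P t)ᵀ = P t) {ε v : ℝ} (hε : 0 < ε)
    (hv : 0 ≤ v) (hQ : ∀ t, 0 ≤ t → ∀ x, ε * (x ⬝ᵥ x) ≤ x ⬝ᵥ (Q t *ᵥ x))
    (hV : ∀ t, 0 ≤ t → ∀ x, x ⬝ᵥ (V t *ᵥ x) ≤ v * (x ⬝ᵥ x)) {t₀ t₁ : ℝ} (ht₀ : 0 ≤ t₀)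
    (ht₁ : t₀ ≤ t₁) {w : ℝ → ι → ℝ} {η : ℝ → κ → ℝ} (hw₀ : w t₀ = 0)
    (hw : ∀ s ∈ Icc t₀ t₁,
      HasDerivWithinAt w (-(A s)ᵀ *ᵥ w s + Cᵀ *ᵥ η s) (Icc t₀ t₁) s)
    {b : ℝ} (hwb : ∀ s ∈ Icc t₀ t₁, w s ⬝ᵥ w s ≤ b) (hηb : ∀ s ∈ Icc t₀ t₁, η s ⬝ᵥ η s ≤ b) :
    w t₁ ⬝ᵥ (P t₁ *ᵥ w t₁) ≤ (v * b + b / ε) * (t₁ - t₀) := by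
  have hsub : Icc t₀ t₁ ⊆ Ici 0 := fun s hs => ht₀.trans hs.1
  have hderiv : ∀ s ∈ Icc t₀ t₁, ∃ d, d ≤ v * b + b / ε ∧
      HasDerivWithinAt (fun s => w s ⬝ᵥ (P s *ᵥ w s)) d (Icc t₀ t₁) s := by
    intro s hs
    have hs0 : 0 ≤ s := hsub hs
    have hPd : HasEntryDeriv P _ (Ici 0) s := hP.2 s hs0
    refine ⟨_, ?_, hasDerivWithinAt_dotProduct (hw s hs) ((hPd.mono hsub).mulVec (hw s hs))⟩
    obtain ⟨p, hp⟩ : ∃ p, p = P s *ᵥ w s := ⟨_, rfl⟩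
    have e1 : w s ⬝ᵥ (P s *ᵥ (-(A s)ᵀ *ᵥ w s + Cᵀ *ᵥ η s))
        = (-(A s)ᵀ *ᵥ w s + Cᵀ *ᵥ η s) ⬝ᵥ p := by
      rw [dotProduct_mulVec_comm_of_symm (hsymm s hs0), hp]
    have e2 : (-(A s)ᵀ *ᵥ w s + Cᵀ *ᵥ η s) ⬝ᵥ p = -(w s ⬝ᵥ (A s *ᵥ p)) + η s ⬝ᵥ (C *ᵥ p) := by
      rw [add_dotProduct, Matrix.neg_mulVec, neg_dotProduct, dotProduct_comm _ p,
        dotProduct_transpose_mulVec, dotProduct_comm _ p, dotProduct_transpose_mulVec,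
        dotProduct_comm (w s), dotProduct_comm (η s)]
    have e3 : w s ⬝ᵥ ((A s * P s + P s * (A s)ᵀ - P s * Cᵀ * Q s * C * P s + V s) *ᵥ w s)
        = 2 * (w s ⬝ᵥ (A s *ᵥ p)) - (C *ᵥ p) ⬝ᵥ (Q s *ᵥ (C *ᵥ p)) + w s ⬝ᵥ (V s *ᵥ w s) := by
      have f1 : w s ⬝ᵥ (P s *ᵥ ((A s)ᵀ *ᵥ w s)) = w s ⬝ᵥ (A s *ᵥ p) := by
        rw [dotProduct_mulVec_comm_of_symm (hsymm s hs0), ← hp, dotProduct_comm,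
          dotProduct_transpose_mulVec, dotProduct_comm]
      have f2 : w s ⬝ᵥ (P s *ᵥ (Cᵀ *ᵥ (Q s *ᵥ (C *ᵥ p)))) = (C *ᵥ p) ⬝ᵥ (Q s *ᵥ (C *ᵥ p)) := by
        rw [dotProduct_mulVec_comm_of_symm (hsymm s hs0), ← hp, dotProduct_comm,
          dotProduct_transpose_mulVec]
      simp only [Matrix.add_mulVec, Matrix.sub_mulVec, dotProduct_add, dotProduct_sub,
        ← Matrix.mulVec_mulVec, ← hp, f1, f2]
      ring
    rw [← hp, dotProduct_add, e1, e2, e3]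
    have h1 := hQ s hs0 (C *ᵥ p)
    have h2 := (hV s hs0 (w s)).trans (mul_le_mul_of_nonneg_left (hwb s hs) hv)
    have h3 := (two_mul_dotProduct_sub_le hε (η s) (C *ᵥ p)).trans
      (div_le_div_of_nonneg_right (hηb s hs) hε.le)
    linarith
  choose! d hd hd' using hderiv
  have hanti : AntitoneOn (fun s => w s ⬝ᵥ (P s *ᵥ w s) - (v * b + b / ε) * (s - t₀))
      (Icc t₀ t₁) := by
    have hd2 : ∀ s ∈ Icc t₀ t₁,
        HasDerivWithinAt (fun s => w s ⬝ᵥ (P s *ᵥ w s) - (v * b + b / ε) * (s - t₀))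
          (d s - (v * b + b / ε)) (Icc t₀ t₁) s := fun s hs => by
      exact ((hd' s hs).fun_sub (((hasDerivWithinAt_id s (Icc t₀ t₁)).sub_const t₀).const_mul
        (v * b + b / ε))).congr_deriv (by simp)
    refine antitoneOn_of_hasDerivWithinAt_nonpos (convex_Icc _ _)
      (f' := fun s => d s - (v * b + b / ε))
      (fun s hs => (hd2 s hs).continuousWithinAt) (fun s hs => ?_) (fun s hs => ?_)
    · exact (hd2 s (interior_subset hs)).mono interior_subset
    · linarith [hd s (interior_subset hs)]
  have := hanti (left_mem_Icc.2 ht₁) (right_mem_Icc.2 ht₁) ht₁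
  simp only [hw₀, zero_dotProduct, sub_self, mul_zero] at this
  linarith

/-- The adjoint system `ẇ = -Aᵀ w + Cᵀ η` can be steered from zero to any state within time `T`,
with a cost which is uniform in the initial time. -/
def AdjointControllable (A : ℝ → Matrix ι ι ℝ) (C : Matrix κ ι ℝ) : Prop :=
  ∃ T c : ℝ, 0 < T ∧ 0 ≤ c ∧ ∀ t₀, 0 ≤ t₀ → ∀ x : ι → ℝ, ∃ (w : ℝ → ι → ℝ) (η : ℝ → κ → ℝ),
    w t₀ = 0 ∧ w (t₀ + T) = x ∧
    ∀ s ∈ Icc t₀ (t₀ + T),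
      HasDerivWithinAt w (-(A s)ᵀ *ᵥ w s + Cᵀ *ᵥ η s) (Icc t₀ (t₀ + T)) s ∧
      w s ⬝ᵥ w s ≤ c * (x ⬝ᵥ x) ∧ η s ⬝ᵥ η s ≤ c * (x ⬝ᵥ x)

theorem IsCRESolution.exists_form_le {A : ℝ → Matrix ι ι ℝ} {C : Matrix κ ι ℝ}
    {Q : ℝ → Matrix κ κ ℝ} {V : ℝ → Matrix ι ι ℝ} {P₀ : Matrix ι ι ℝ} {P : ℝ → Matrix ι ι ℝ}
    (hP : IsCRESolution A C Q V P₀ P) (hsymm : ∀ t, 0 ≤ t → (P t)ᵀ = P t) {ε v : ℝ} (hε : 0 < ε)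
    (hv : 0 ≤ v) (hQ : ∀ t, 0 ≤ t → ∀ x, ε * (x ⬝ᵥ x) ≤ x ⬝ᵥ (Q t *ᵥ x))
    (hV : ∀ t, 0 ≤ t → ∀ x, x ⬝ᵥ (V t *ᵥ x) ≤ v * (x ⬝ᵥ x)) (hAC : AdjointControllable A C) :
    ∃ b, 0 < b ∧ ∀ t, 0 ≤ t → ∀ x, x ⬝ᵥ (P t *ᵥ x) ≤ b * (x ⬝ᵥ x) := by
  obtain ⟨T, c, hT, hc, hctrl⟩ := hAC
  have hPd : ∀ t, 0 ≤ t → HasEntryDeriv P _ (Ici 0) t := hP.2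
  have hPc : ContinuousOn P (Icc 0 T) := fun t ht =>
    ((hPd t ht.1).mono Icc_subset_Ici_self).continuousWithinAt
  obtain ⟨b₀, hb₀, hb₀'⟩ := exists_form_le_on_Icc hPc
  have hb₁ : 0 ≤ (v * c + c / ε) * T := by positivity
  refine ⟨b₀ + (v * c + c / ε) * T + 1, by linarith, fun t ht x => ?_⟩
  have hx := dotProduct_self_nonneg' x
  rcases le_total t T with htT | htT
  · refine (hb₀' t ⟨ht, htT⟩ x).trans (mul_le_mul_of_nonneg_right (by linarith) hx)
  · obtain ⟨w, η, hw₀, hw₁, hw⟩ := hctrl (t - T) (sub_nonneg.2 htT) x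
    rw [sub_add_cancel] at hw₁ hw
    have := hP.form_le_of_control hsymm hε hv hQ hV (sub_nonneg.2 htT) (by linarith) hw₀
      (fun s hs => (hw s hs).1) (fun s hs => (hw s hs).2.1) (fun s hs => (hw s hs).2.2)
    rw [hw₁] at this
    refine this.trans ?_
    have e : (v * (c * (x ⬝ᵥ x)) + c * (x ⬝ᵥ x) / ε) * (t - (t - T))
        = (v * c + c / ε) * T * (x ⬝ᵥ x) := by ring
    rw [e]
    exact mul_le_mul_of_nonneg_right (by linarith) hx

end RiccatiBound

section Lyapunov

variable {ι κ : Type*} [Fintype ι] [Fintype κ]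

lemma norm_toLp_sq (x : ι → ℝ) : ‖WithLp.toLp 2 x‖ ^ 2 = x ⬝ᵥ x := by
  rw [EuclideanSpace.real_norm_sq_eq]
  simp [dotProduct, pow_two]

variable [DecidableEq ι]

lemma dotProduct_self_le_mul_inv_form {P : Matrix ι ι ℝ} (hP : P.PosDef) {p : ℝ} (hp : 0 < p)
    (h : ∀ x, x ⬝ᵥ (P *ᵥ x) ≤ p * (x ⬝ᵥ x)) (x : ι → ℝ) :
    x ⬝ᵥ x ≤ p * (x ⬝ᵥ (P⁻¹ *ᵥ x)) := by
  have h1 : P *ᵥ (P⁻¹ *ᵥ x) = x := by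
    rw [Matrix.mulVec_mulVec, Matrix.mul_nonsing_inv _ hP.det_pos.ne'.isUnit, Matrix.one_mulVec]
  have h2 := hP.posSemidef.dotProduct_mulVec_nonneg (x - p • (P⁻¹ *ᵥ x))
  have hs : Pᵀ = P := hP.1
  have h3 : (P⁻¹ *ᵥ x) ⬝ᵥ (P *ᵥ x) = x ⬝ᵥ x := by
    rw [dotProduct_mulVec_comm_of_symm hs, h1]
  simp only [star_trivial, Matrix.mulVec_sub, Matrix.mulVec_smul, sub_dotProduct, dotProduct_sub,
    smul_dotProduct, dotProduct_smul, smul_eq_mul, h1, h3, dotProduct_comm (P⁻¹ *ᵥ x) x] at h2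
  have h4 := h x
  by_contra! hlt
  nlinarith

/-- The Lyapunov function `eᵀ P⁻¹ e` of the error dynamics `ė = (A - k P Cᵀ Q C) e` has derivative
at most `-ε |P⁻¹ e|²`. -/
lemma IsCRESolution.exists_lyapunov_deriv_le {A : ℝ → Matrix ι ι ℝ} {C : Matrix κ ι ℝ}
    {Q : ℝ → Matrix κ κ ℝ} {V : ℝ → Matrix ι ι ℝ} {P₀ : Matrix ι ι ℝ} {P : ℝ → Matrix ι ι ℝ}
    (hP : IsCRESolution A C Q V P₀ P) (hpos : ∀ t, 0 ≤ t → (P t).PosDef)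
    (hQ : ∀ t, 0 ≤ t → (Q t).PosSemidef) {ε : ℝ}
    (hV : ∀ t, 0 ≤ t → ∀ x, ε * (x ⬝ᵥ x) ≤ x ⬝ᵥ (V t *ᵥ x)) {k : ℝ → ℝ}
    (hk : ∀ t, 0 ≤ t → 1 / 2 ≤ k t) {e : ℝ → ι → ℝ} {t : ℝ} (ht : 0 ≤ t)
    (he : HasDerivWithinAt e
      (A t *ᵥ e t - (k t • (P t * Cᵀ * Q t)) *ᵥ (C *ᵥ e t)) (Ici 0) t) :
    ∃ d, d ≤ -ε * (((P t)⁻¹ *ᵥ e t) ⬝ᵥ ((P t)⁻¹ *ᵥ e t)) ∧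
      HasDerivWithinAt (fun t => e t ⬝ᵥ ((P t)⁻¹ *ᵥ e t)) d (Ici 0) t := by
  have hS : HasEntryDeriv (fun t => (P t)⁻¹) _ (Ici 0) t := (hP.inv hpos).2 t ht
  refine ⟨_, ?_, hasDerivWithinAt_dotProduct he (hS.mulVec he)⟩
  have hPs : (P t)ᵀ = P t := (hpos t ht).1
  have hSs : ((P t)⁻¹)ᵀ = (P t)⁻¹ := by rw [Matrix.transpose_nonsing_inv, hPs]
  obtain ⟨z, hz⟩ : ∃ z, z = (P t)⁻¹ *ᵥ e t := ⟨_, rfl⟩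
  have hPz : P t *ᵥ z = e t := by
    rw [hz, Matrix.mulVec_mulVec, Matrix.mul_nonsing_inv _ (hpos t ht).det_pos.ne'.isUnit,
      Matrix.one_mulVec]
  obtain ⟨y, hy⟩ : ∃ y, y = C *ᵥ e t := ⟨_, rfl⟩
  have f0 : z ⬝ᵥ (P t *ᵥ (Cᵀ *ᵥ (Q t *ᵥ y))) = y ⬝ᵥ (Q t *ᵥ y) := by
    rw [dotProduct_mulVec_comm_of_symm hPs, hPz, dotProduct_comm, dotProduct_transpose_mulVec, hy]
  have e0 : (A t *ᵥ e t - (k t • (P t * Cᵀ * Q t)) *ᵥ y) ⬝ᵥ z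
      = z ⬝ᵥ (A t *ᵥ e t) - k t * (y ⬝ᵥ (Q t *ᵥ y)) := by
    rw [dotProduct_comm, dotProduct_sub, Matrix.smul_mulVec, dotProduct_smul, smul_eq_mul,
      ← Matrix.mulVec_mulVec, ← Matrix.mulVec_mulVec, f0]
  have e1 : e t ⬝ᵥ ((P t)⁻¹ *ᵥ (A t *ᵥ e t - (k t • (P t * Cᵀ * Q t)) *ᵥ y))
      = z ⬝ᵥ (A t *ᵥ e t) - k t * (y ⬝ᵥ (Q t *ᵥ y)) := by
    rw [dotProduct_mulVec_comm_of_symm hSs, ← hz, e0]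
  have e2 : e t ⬝ᵥ ((-(A t)ᵀ * (P t)⁻¹ + (P t)⁻¹ * (-(A t)ᵀ)ᵀ - (P t)⁻¹ * (1 : Matrix ι ι ℝ)ᵀ *
      V t * (1 : Matrix ι ι ℝ) * (P t)⁻¹ + Cᵀ * Q t * C) *ᵥ e t)
      = -2 * (z ⬝ᵥ (A t *ᵥ e t)) - z ⬝ᵥ (V t *ᵥ z) + y ⬝ᵥ (Q t *ᵥ y) := by
    have g1 : e t ⬝ᵥ ((A t)ᵀ *ᵥ z) = z ⬝ᵥ (A t *ᵥ e t) := by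
      rw [dotProduct_transpose_mulVec, dotProduct_comm]
    have g2 : e t ⬝ᵥ ((P t)⁻¹ *ᵥ (A t *ᵥ e t)) = z ⬝ᵥ (A t *ᵥ e t) := by
      rw [dotProduct_mulVec_comm_of_symm hSs, ← hz, dotProduct_comm]
    have g3 : e t ⬝ᵥ ((P t)⁻¹ *ᵥ (V t *ᵥ z)) = z ⬝ᵥ (V t *ᵥ z) := by
      rw [dotProduct_mulVec_comm_of_symm hSs, ← hz, dotProduct_comm]
    have g4 : e t ⬝ᵥ (Cᵀ *ᵥ (Q t *ᵥ y)) = y ⬝ᵥ (Q t *ᵥ y) := by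
      rw [dotProduct_transpose_mulVec, hy]
    simp only [Matrix.transpose_neg, Matrix.transpose_transpose, Matrix.transpose_one,
      Matrix.mul_one, Matrix.add_mulVec, Matrix.sub_mulVec, dotProduct_add, dotProduct_sub,
      ← Matrix.mulVec_mulVec, ← hz, ← hy, Matrix.neg_mulVec, Matrix.mulVec_neg, dotProduct_neg,
      g1, g2, g3, g4]
    ring
  rw [← hy, ← hz, dotProduct_add, e0, e1, e2]
  have h1 := hV t ht z
  have h2 := (hQ t ht).dotProduct_mulVec_nonneg y
  rw [star_trivial] at h2
  nlinarith [hk t ht]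

/-- If a positive definite Riccati solution and its inverse are bounded, then the error dynamics is
globally exponentially stable. -/
theorem IsCRESolution.globallyExponentiallyStable {A : ℝ → Matrix ι ι ℝ} {C : Matrix κ ι ℝ}
    {Q : ℝ → Matrix κ κ ℝ} {V : ℝ → Matrix ι ι ℝ} {P₀ : Matrix ι ι ℝ} {P : ℝ → Matrix ι ι ℝ}
    (hP : IsCRESolution A C Q V P₀ P) (hpos : ∀ t, 0 ≤ t → (P t).PosDef)
    (hQ : ∀ t, 0 ≤ t → (Q t).PosSemidef) {ε p q : ℝ} (hε : 0 < ε) (hp : 0 < p) (hq : 0 < q)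
    (hV : ∀ t, 0 ≤ t → ∀ x, ε * (x ⬝ᵥ x) ≤ x ⬝ᵥ (V t *ᵥ x)) {k : ℝ → ℝ}
    (hk : ∀ t, 0 ≤ t → 1 / 2 ≤ k t)
    (hPp : ∀ t, 0 ≤ t → ∀ x, x ⬝ᵥ (P t *ᵥ x) ≤ p * (x ⬝ᵥ x))
    (hPq : ∀ t, 0 ≤ t → ∀ x, x ⬝ᵥ ((P t)⁻¹ *ᵥ x) ≤ q * (x ⬝ᵥ x))
    {E : Set (ℝ → ι → ℝ)} (hE : ∀ e ∈ E, ∀ t, 0 ≤ t → HasDerivWithinAt e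
      (A t *ᵥ e t - (k t • (P t * Cᵀ * Q t)) *ᵥ (C *ᵥ e t)) (Ici 0) t) :
    GloballyExponentiallyStable E := by
  obtain ⟨r, hr⟩ : ∃ r, r = ε / p := ⟨_, rfl⟩
  have hr0 : 0 < r := hr ▸ div_pos hε hp
  refine ⟨Real.sqrt (p * q), r / 2, by positivity, by positivity, fun e he t₀ t ht₀ htt => ?_⟩
  have ht : 0 ≤ t := ht₀.trans htt
  set L : ℝ → ℝ := fun t => e t ⬝ᵥ ((P t)⁻¹ *ᵥ e t) with hL
  have hder : ∀ t, 0 ≤ t → ∃ d, d ≤ -r * L t ∧ HasDerivWithinAt L d (Ici 0) t := fun t ht => by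
    obtain ⟨d, hd, hd'⟩ := hP.exists_lyapunov_deriv_le hpos hQ hV hk ht (hE e he t ht)
    refine ⟨d, hd.trans ?_, hd'⟩
    have hPz : P t *ᵥ ((P t)⁻¹ *ᵥ e t) = e t := by
      rw [Matrix.mulVec_mulVec, Matrix.mul_nonsing_inv _ (hpos t ht).det_pos.ne'.isUnit,
        Matrix.one_mulVec]
    have h1 := hPp t ht ((P t)⁻¹ *ᵥ e t)
    rw [hPz, dotProduct_comm] at h1
    have h2 : r * L t ≤ r * (p * (((P t)⁻¹ *ᵥ e t) ⬝ᵥ ((P t)⁻¹ *ᵥ e t))) :=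
      mul_le_mul_of_nonneg_left h1 hr0.le
    have h3 : r * p = ε := by rw [hr]; field_simp
    rw [← mul_assoc, h3] at h2
    linarith
  choose! d hd hd' using hder
  have hmono : MonotoneOn (fun t => -(L t * Real.exp (r * t))) (Ici 0) := by
    refine monotoneOn_Ici_of_hasDerivWithinAt
      (f' := fun t => -(d t * Real.exp (r * t) + L t * (Real.exp (r * t) * r)))
      (fun t ht => ?_) (fun t ht => ?_)
    · have hexp : HasDerivWithinAt (fun t => Real.exp (r * t)) (Real.exp (r * t) * r) (Ici 0) t :=
        (((hasDerivAt_id t).const_mul r).exp.congr_deriv (by simp)).hasDerivWithinAt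
      exact ((hd' t ht).mul hexp).neg
    · have := mul_le_mul_of_nonneg_right (hd t ht) (Real.exp_pos (r * t)).le
      linarith
  have hdec : L t * Real.exp (r * t) ≤ L t₀ * Real.exp (r * t₀) :=
    neg_le_neg_iff.1 (hmono (mem_Ici.2 ht₀) (mem_Ici.2 ht) htt)
  have hdec' : L t ≤ L t₀ * Real.exp (-r * (t - t₀)) := by
    have h1 : Real.exp (-r * (t - t₀)) = Real.exp (r * t₀) / Real.exp (r * t) := by
      rw [← Real.exp_sub]; congr 1; ring
    rw [h1, ← mul_div_assoc, le_div_iff₀ (Real.exp_pos _)]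
    exact hdec
  have hsq : ‖WithLp.toLp 2 (e t)‖ ^ 2 ≤
      (Real.sqrt (p * q) * Real.exp (-(r / 2) * (t - t₀)) * ‖WithLp.toLp 2 (e t₀)‖) ^ 2 := by
    rw [mul_pow, mul_pow, Real.sq_sqrt (by positivity), norm_toLp_sq, norm_toLp_sq,
      ← Real.exp_nat_mul]
    have h1 := dotProduct_self_le_mul_inv_form (hpos t ht) hp (hPp t ht) (e t)
    have h2 := hPq t₀ ht₀ (e t₀)
    have h3 : (2 : ℕ) * (-(r / 2) * (t - t₀)) = -r * (t - t₀) := by push_cast; ring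
    rw [h3]
    calc e t ⬝ᵥ e t ≤ p * L t := h1
      _ ≤ p * (q * (e t₀ ⬝ᵥ e t₀) * Real.exp (-r * (t - t₀))) := by
          refine mul_le_mul_of_nonneg_left (hdec'.trans ?_) hp.le
          exact mul_le_mul_of_nonneg_right h2 (Real.exp_pos _).le
      _ = _ := by ring
  exact (pow_le_pow_iff_left₀ (norm_nonneg _) (by positivity) two_ne_zero).1 hsq

end Lyapunov

section Steering

variable {E : Type*} [NormedAddCommGroup E] [InnerProductSpace ℝ E]

/-- The operator `a ↦ δ M a + ∫ b(s - t₀) ⟪g(s), a⟫ u(s) ds` over `[t₀, t₀ + δ]`. -/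
noncomputable def steeringGramian (M : E →L[ℝ] E) (u g : ℝ → E) (b : ℝ → ℝ) (δ t₀ : ℝ) :
    E →L[ℝ] E :=
  δ • M + ∫ s in t₀..(t₀ + δ), b (s - t₀) • (innerSL ℝ (g s)).smulRight (u s)

lemma continuous_steeringGramian_integrand {u g : ℝ → E} {b : ℝ → ℝ} (hu : Continuous u)
    (hg : Continuous g) (hb : Continuous b) (t₀ : ℝ) :
    Continuous fun s => b (s - t₀) • (innerSL ℝ (g s)).smulRight (u s) := by
  refine (hb.comp (continuous_id.sub continuous_const)).smul ?_
  have h : Continuous fun s => ContinuousLinearMap.smulRightL ℝ E E (innerSL ℝ (g s)) (u s) :=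
    ((ContinuousLinearMap.smulRightL ℝ E E).continuous.comp
      ((innerSL ℝ).continuous.comp hg)).clm_apply hu
  exact h

lemma steeringGramian_apply {M : E →L[ℝ] E} {u g : ℝ → E} {b : ℝ → ℝ} (hu : Continuous u)
    (hg : Continuous g) (hb : Continuous b) (δ t₀ : ℝ) (a : E) :
    steeringGramian M u g b δ t₀ a =
      δ • M a + ∫ s in t₀..(t₀ + δ), (b (s - t₀) * inner ℝ (g s) a) • u s := by
  rw [steeringGramian, _root_.add_apply, _root_.smul_apply,
    ContinuousLinearMap.intervalIntegral_apply
      ((continuous_steeringGramian_integrand hu hg hb t₀).intervalIntegrable _ _)]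
  simp [mul_smul]

variable [FiniteDimensional ℝ E]

lemma inner_steeringGramian {M : E →L[ℝ] E} {u g : ℝ → E} {b : ℝ → ℝ} (hu : Continuous u)
    (hg : Continuous g) (hb : Continuous b) (δ t₀ : ℝ) (a : E) :
    inner ℝ a (steeringGramian M u g b δ t₀ a) = δ * inner ℝ a (M a) +
      ∫ s in t₀..(t₀ + δ), b (s - t₀) * inner ℝ (g s) a * inner ℝ (u s) a := by
  have hc : Continuous fun s => (b (s - t₀) * inner ℝ (g s) a) • u s := by fun_prop
  rw [steeringGramian_apply hu hg hb, inner_add_right, inner_smul_right]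
  congr 1
  have := (innerSL ℝ a).intervalIntegral_comp_comm (μ := MeasureTheory.volume)
    (hc.intervalIntegrable t₀ (t₀ + δ))
  simp only [innerSL_apply_apply, inner_smul_right] at this
  rw [← this]
  simp only [real_inner_comm]

/-- If the steering Gramian is coercive, uniformly in time, then the system
`ẇ₁ = M a - w₂ u`, `ẇ₂ = η` can be steered from zero to any state within time `δ`, at a cost which
is uniform in the initial time. -/
theorem exists_steering {M : E →L[ℝ] E} {u g g' : ℝ → E} {b b' : ℝ → ℝ} {δ ν B Bg Bb : ℝ}
    (hδ : 0 < δ) (hν : 0 < ν) (hu : Continuous u) (huB : ∀ t, ‖u t‖ ≤ B)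
    (hg : ∀ t, HasDerivAt g (g' t) t) (hgB : ∀ t, ‖g t‖ ≤ Bg) (hgB' : ∀ t, ‖g' t‖ ≤ Bg)
    (hb : ∀ t, HasDerivAt b (b' t) t) (hb0 : b 0 = 0) (hbδ : b δ = 0)
    (hb1 : ∀ t ∈ Icc 0 δ, |b t| ≤ 1) (hbB : ∀ t ∈ Icc 0 δ, |b' t| ≤ Bb)
    (hcoer : ∀ t₀, 0 ≤ t₀ → ∀ a, ν * ‖a‖ ^ 2 ≤ inner ℝ a (steeringGramian M u g b δ t₀ a)) :
    ∃ c, 0 ≤ c ∧ ∀ t₀, 0 ≤ t₀ → ∀ (x₁ : E) (x₂ : ℝ), ∃ (a : E) (w₁ : ℝ → E) (w₂ η : ℝ → ℝ),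
      w₁ t₀ = 0 ∧ w₂ t₀ = 0 ∧ w₁ (t₀ + δ) = x₁ ∧ w₂ (t₀ + δ) = x₂ ∧
      ‖a‖ ≤ c * (‖x₁‖ + |x₂|) ∧ ∀ s ∈ Icc t₀ (t₀ + δ),
        HasDerivAt w₁ (M a - w₂ s • u s) s ∧ HasDerivAt w₂ (η s) s ∧
        ‖w₁ s‖ ≤ c * (‖x₁‖ + |x₂|) ∧ |w₂ s| ≤ c * (‖x₁‖ + |x₂|) ∧
        |η s| ≤ c * (‖x₁‖ + |x₂|) := by
  have hgc : Continuous g := continuous_iff_continuousAt.2 fun t => (hg t).continuousAt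
  have hbc : Continuous b := continuous_iff_continuousAt.2 fun t => (hb t).continuousAt
  have hB : 0 ≤ B := (norm_nonneg _).trans (huB 0)
  have hBg : 0 ≤ Bg := (norm_nonneg _).trans (hgB 0)
  have hBb : 0 ≤ Bb := (abs_nonneg _).trans (hbB 0 ⟨le_rfl, hδ.le⟩)
  obtain ⟨ca, hca⟩ : ∃ ca, ca = (1 + B * δ) / ν := ⟨_, rfl⟩
  have hca0 : 0 ≤ ca := by rw [hca]; positivity
  obtain ⟨c2, hc2⟩ : ∃ c2, c2 = 1 + Bg * ca := ⟨_, rfl⟩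
  obtain ⟨c3, hc3⟩ : ∃ c3, c3 = 1 / δ + (Bb * Bg + Bg) * ca := ⟨_, rfl⟩
  obtain ⟨c1, hc1⟩ : ∃ c1, c1 = (‖M‖ * ca + c2 * B) * δ := ⟨_, rfl⟩
  have hc20 : 0 ≤ c2 := by rw [hc2]; positivity
  have hc30 : 0 ≤ c3 := by rw [hc3]; positivity
  have hc10 : 0 ≤ c1 := by rw [hc1]; positivity
  refine ⟨ca + c1 + c2 + c3, by positivity, fun t₀ ht₀ x₁ x₂ => ?_⟩
  obtain ⟨N, hN⟩ : ∃ N, N = ‖x₁‖ + |x₂| := ⟨_, rfl⟩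
  have hN0 : 0 ≤ N := by rw [hN]; positivity
  have hx₁ : ‖x₁‖ ≤ N := by rw [hN]; linarith [abs_nonneg x₂]
  have hx₂ : |x₂| ≤ N := by rw [hN]; linarith [norm_nonneg x₁]
  rw [← hN]
  set G := steeringGramian M u g b δ t₀ with hG
  have hρ : ∀ s ∈ Icc t₀ (t₀ + δ), |(s - t₀) / δ| ≤ 1 := fun s hs => by
    rw [abs_of_nonneg (div_nonneg (sub_nonneg.2 hs.1) hδ.le), div_le_one hδ]
    linarith [hs.2]
  have hinj : Function.Injective G := by
    refine (injective_iff_map_eq_zero G).2 fun a ha => ?_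
    have := hcoer t₀ ht₀ a
    rw [← hG, ha, inner_zero_right] at this
    have h0 : ‖a‖ ^ 2 ≤ 0 := by nlinarith [sq_nonneg ‖a‖]
    exact norm_eq_zero.1 (pow_eq_zero_iff two_ne_zero |>.1 (le_antisymm h0 (sq_nonneg _)))
  have hsurj : Function.Surjective G :=
    (LinearMap.injective_iff_surjective (f := (G : E →ₗ[ℝ] E))).1 hinj
  obtain ⟨a, ha⟩ := hsurj (x₁ + ∫ s in t₀..(t₀ + δ), ((s - t₀) / δ * x₂) • u s)
  have hle : t₀ ≤ t₀ + δ := by linarith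
  have hy : ‖G a‖ ≤ (1 + B * δ) * N := by
    rw [ha]
    have h1 : ‖∫ s in t₀..(t₀ + δ), ((s - t₀) / δ * x₂) • u s‖ ≤ N * B * |t₀ + δ - t₀| := by
      refine intervalIntegral.norm_integral_le_of_norm_le_const fun s hs => ?_
      rw [uIoc_of_le hle] at hs
      rw [norm_smul, Real.norm_eq_abs, abs_mul]
      have h2 : |(s - t₀) / δ| * |x₂| ≤ 1 * N :=
        mul_le_mul (hρ s ⟨hs.1.le, hs.2⟩) hx₂ (abs_nonneg _) zero_le_one
      rw [one_mul] at h2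
      exact mul_le_mul h2 (huB s) (norm_nonneg _) hN0
    rw [add_sub_cancel_left, abs_of_pos hδ] at h1
    refine (norm_add_le _ _).trans ?_
    nlinarith
  have hanorm : ‖a‖ ≤ ca * N := by
    have h1 := (hcoer t₀ ht₀ a).trans (real_inner_le_norm a (G a))
    have h2 : ν * ‖a‖ ≤ (1 + B * δ) * N := by
      rcases (norm_nonneg a).eq_or_lt with h | h
      · rw [← h, mul_zero]; positivity
      · refine le_trans ?_ hy
        refine le_of_mul_le_mul_left ?_ h
        linarith
    rw [hca, div_mul_eq_mul_div, le_div_iff₀ hν]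
    linarith
  have hga : ∀ s, |inner ℝ (g s) a| ≤ Bg * (ca * N) := fun s =>
    (abs_real_inner_le_norm _ _).trans
      (mul_le_mul (hgB s) hanorm (norm_nonneg _) hBg)
  have hga' : ∀ s, |inner ℝ (g' s) a| ≤ Bg * (ca * N) := fun s =>
    (abs_real_inner_le_norm _ _).trans
      (mul_le_mul (hgB' s) hanorm (norm_nonneg _) hBg)
  set w₂ : ℝ → ℝ := fun s => (s - t₀) / δ * x₂ - b (s - t₀) * inner ℝ (g s) a with hw₂
  set F : ℝ → E := fun s => M a - w₂ s • u s with hF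
  have hw₂c : Continuous w₂ := by rw [hw₂]; fun_prop
  have hFc : Continuous F := continuous_const.sub (hw₂c.smul hu)
  have hmem : ∀ s ∈ Icc t₀ (t₀ + δ), s - t₀ ∈ Icc 0 δ := fun s hs =>
    ⟨sub_nonneg.2 hs.1, by linarith [hs.2]⟩
  have hw₂b : ∀ s ∈ Icc t₀ (t₀ + δ), |w₂ s| ≤ c2 * N := fun s hs => by
    refine (abs_sub _ _).trans ?_
    rw [abs_mul, abs_mul]
    have h1 : |(s - t₀) / δ| * |x₂| ≤ 1 * N :=
      mul_le_mul (hρ s hs) hx₂ (abs_nonneg _) zero_le_one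
    have h2 : |b (s - t₀)| * |inner ℝ (g s) a| ≤ 1 * (Bg * (ca * N)) :=
      mul_le_mul (hb1 _ (hmem s hs)) (hga s) (abs_nonneg _) zero_le_one
    rw [hc2]
    linarith
  have hFb : ∀ s ∈ Icc t₀ (t₀ + δ), ‖F s‖ ≤ (‖M‖ * ca + c2 * B) * N := fun s hs => by
    refine (norm_sub_le _ _).trans ?_
    have h1 : ‖M a‖ ≤ ‖M‖ * (ca * N) :=
      (M.le_opNorm a).trans (mul_le_mul_of_nonneg_left hanorm (norm_nonneg _))
    have h2 : ‖w₂ s • u s‖ ≤ c2 * N * B := by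
      rw [norm_smul]
      exact mul_le_mul (hw₂b s hs) (huB s) (norm_nonneg _) (by positivity)
    linarith
  refine ⟨a, fun s => ∫ τ in t₀..s, F τ, w₂, fun s => 1 / δ * x₂ -
    (b' (s - t₀) * inner ℝ (g s) a + b (s - t₀) * inner ℝ (g' s) a), by simp, by simp [hw₂, hb0],
    ?_, by simp [hw₂, hbδ, hδ.ne'], ?_, fun s hs => ⟨?_, ?_, ?_, ?_, ?_⟩⟩
  · have h1 : Continuous fun s => (b (s - t₀) * inner ℝ (g s) a) • u s := by fun_prop
    have h2 : Continuous fun s => ((s - t₀) / δ * x₂) • u s := by fun_prop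
    have h12 : Continuous fun s => (b (s - t₀) * inner ℝ (g s) a) • u s
        - ((s - t₀) / δ * x₂) • u s := h1.sub h2
    have h3 : ∀ s, F s = M a + ((b (s - t₀) * inner ℝ (g s) a) • u s
        - ((s - t₀) / δ * x₂) • u s) := fun s => by
      simp only [hF, hw₂, sub_smul]; abel
    have h4 := steeringGramian_apply (M := M) hu hgc hbc δ t₀ a
    rw [← hG, ha] at h4
    simp only [h3]
    rw [intervalIntegral.integral_add (continuous_const.intervalIntegrable _ _)
      (h12.intervalIntegrable _ _),
      intervalIntegral.integral_sub (h1.intervalIntegrable _ _) (h2.intervalIntegrable _ _),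
      intervalIntegral.integral_const, add_sub_cancel_left, ← add_sub_assoc, ← h4,
      add_sub_cancel_right]
  · refine hanorm.trans (mul_le_mul_of_nonneg_right ?_ hN0); linarith
  · exact (hFc.integral_hasStrictDerivAt t₀ s).hasDerivAt
  · have h1 : HasDerivAt (fun s => (s - t₀) / δ * x₂) (1 / δ * x₂) s :=
      (((hasDerivAt_id s).sub_const t₀).div_const δ).mul_const x₂
    have h2 : HasDerivAt (fun s => b (s - t₀)) (b' (s - t₀)) s :=
      (hb (s - t₀)).comp_sub_const s t₀
    have h3 : HasDerivAt (fun s => inner ℝ (g s) a) (inner ℝ (g' s) a) s := by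
      simpa using (hg s).inner ℝ (hasDerivAt_const s a)
    exact h1.fun_sub (h2.fun_mul h3)
  · have h1 : ‖∫ τ in t₀..s, F τ‖ ≤ (‖M‖ * ca + c2 * B) * N * |s - t₀| := by
      refine intervalIntegral.norm_integral_le_of_norm_le_const fun τ hτ => ?_
      rw [uIoc_of_le hs.1] at hτ
      exact hFb τ ⟨hτ.1.le, hτ.2.trans hs.2⟩
    have h2 : |s - t₀| ≤ δ := by
      rw [abs_of_nonneg (sub_nonneg.2 hs.1)]; linarith [hs.2]
    have h3 : (‖M‖ * ca + c2 * B) * N * |s - t₀| ≤ (‖M‖ * ca + c2 * B) * N * δ :=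
      mul_le_mul_of_nonneg_left h2 (by positivity)
    have h4 : (‖M‖ * ca + c2 * B) * N * δ = c1 * N := by rw [hc1]; ring
    refine (h1.trans (h3.trans h4.le)).trans (mul_le_mul_of_nonneg_right ?_ hN0)
    linarith
  · refine (hw₂b s hs).trans (mul_le_mul_of_nonneg_right ?_ hN0); linarith
  · have h1 : |1 / δ * x₂| ≤ 1 / δ * N := by
      rw [abs_mul, abs_of_pos (by positivity : 0 < 1 / δ)]
      exact mul_le_mul_of_nonneg_left hx₂ (by positivity)
    have h2 : |b' (s - t₀) * inner ℝ (g s) a| ≤ Bb * (Bg * (ca * N)) := by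
      rw [abs_mul]
      exact mul_le_mul (hbB _ (hmem s hs)) (hga s) (abs_nonneg _) hBb
    have h3 : |b (s - t₀) * inner ℝ (g' s) a| ≤ 1 * (Bg * (ca * N)) := by
      rw [abs_mul]
      exact mul_le_mul (hb1 _ (hmem s hs)) (hga' s) (abs_nonneg _) zero_le_one
    have h4 := abs_sub (1 / δ * x₂)
      (b' (s - t₀) * inner ℝ (g s) a + b (s - t₀) * inner ℝ (g' s) a)
    have h5 := abs_add_le (b' (s - t₀) * inner ℝ (g s) a) (b (s - t₀) * inner ℝ (g' s) a)
    have h6 : |1 / δ * x₂ - (b' (s - t₀) * inner ℝ (g s) a + b (s - t₀) * inner ℝ (g' s) a)|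
        ≤ c3 * N := by
      rw [hc3]; linarith
    refine h6.trans (mul_le_mul_of_nonneg_right ?_ hN0); linarith

end Steering

section Controllability

/-- With full control, the adjoint of `-Aᵀ` is controllable as soon as `A` is bounded. -/
theorem adjointControllable_neg_transpose_one {ι : Type*} [Fintype ι] [DecidableEq ι]
    {A : ℝ → Matrix ι ι ℝ} {b : ℝ} (hb : 0 ≤ b)
    (hA : ∀ t, 0 ≤ t → ∀ x, (A t *ᵥ x) ⬝ᵥ (A t *ᵥ x) ≤ b * (x ⬝ᵥ x)) :
    AdjointControllable (fun t => -(A t)ᵀ) (1 : Matrix ι ι ℝ) := by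
  refine ⟨1, 2 + 2 * b, one_pos, by positivity, fun t₀ ht₀ x =>
    ⟨fun s => (s - t₀) • x, fun s => x - (s - t₀) • (A s *ᵥ x), by simp, by simp,
      fun s hs => ⟨?_, ?_, ?_⟩⟩⟩
  · refine ((((hasDerivAt_id s).sub_const t₀).smul_const x).congr_deriv ?_).hasDerivWithinAt
    simp [Matrix.mulVec_smul]
  all_goals
    have hs0 : 0 ≤ s - t₀ := sub_nonneg.2 hs.1
    have hs1 : s - t₀ ≤ 1 := by linarith [hs.2]
    have hs2 : (s - t₀) * (s - t₀) ≤ 1 := by nlinarith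
    have hx := dotProduct_self_nonneg' x
  · simp only [smul_dotProduct, dotProduct_smul, smul_eq_mul, ← mul_assoc]
    exact mul_le_mul_of_nonneg_right (by linarith) hx
  · obtain ⟨y, hy⟩ : ∃ y, y = (s - t₀) • (A s *ᵥ x) := ⟨_, rfl⟩
    have h1 : y ⬝ᵥ y ≤ b * (x ⬝ᵥ x) := by
      rw [hy]
      simp only [smul_dotProduct, dotProduct_smul, smul_eq_mul, ← mul_assoc]
      have h2 := hA s (ht₀.trans hs.1) x
      have h3 := dotProduct_self_nonneg' (A s *ᵥ x)
      nlinarith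
    have h2 := dotProduct_self_nonneg' (x + y)
    simp only [dotProduct_add, add_dotProduct] at h2
    simp only [← hy, dotProduct_sub, sub_dotProduct]
    linarith

variable {n l : ℕ}

lemma stateMatrix_mulVec_dotProduct_le {u : EuclideanSpace ℝ (Fin n)} {B : ℝ} (hu : ‖u‖ ≤ B)
    (x : StateIdx n → ℝ) :
    (stateMatrix u *ᵥ x) ⬝ᵥ (stateMatrix u *ᵥ x) ≤ B ^ 2 * (x ⬝ᵥ x) := by
  have h1 : (stateMatrix u *ᵥ x) ⬝ᵥ (stateMatrix u *ᵥ x)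
      = (inner ℝ u (WithLp.toLp 2 fun i => x (Sum.inl i)) : ℝ) ^ 2 := by
    simp [dotProduct, stateMatrix, Matrix.mulVec, PiLp.inner_apply, pow_two, mul_comm]
  have h2 : x ⬝ᵥ x = ‖WithLp.toLp 2 fun i : Fin n => x (Sum.inl i)‖ ^ 2 + x (Sum.inr ()) ^ 2 := by
    rw [norm_toLp_sq]
    simp [dotProduct, pow_two]
  have h3 := abs_real_inner_le_norm u (WithLp.toLp 2 fun i : Fin n => x (Sum.inl i))
  rw [h1, h2, ← sq_abs]
  refine (pow_le_pow_left₀ (abs_nonneg _) h3 2).trans ?_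
  rw [mul_pow]
  exact mul_le_mul (pow_le_pow_left₀ (norm_nonneg _) hu 2) (by linarith [sq_nonneg (x (Sum.inr ()))])
    (sq_nonneg _) (sq_nonneg _)

/-- `Wᵀ W` as an operator on Euclidean space. -/
noncomputable def gramOperator (W : Matrix (Fin l) (Fin n) ℝ) :
    EuclideanSpace ℝ (Fin n) →L[ℝ] EuclideanSpace ℝ (Fin n) :=
  (Matrix.toEuclideanLin (Wᵀ * W)).toContinuousLinearMap

lemma gramOperator_apply (W : Matrix (Fin l) (Fin n) ℝ) (a : EuclideanSpace ℝ (Fin n)) (i : Fin n) :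
    gramOperator W a i = (Wᵀ *ᵥ (W *ᵥ WithLp.ofLp a)) i := by
  simp [gramOperator, Matrix.toLpLin_apply, Matrix.mulVec_mulVec]

lemma inner_gramOperator (W : Matrix (Fin l) (Fin n) ℝ) (a : EuclideanSpace ℝ (Fin n)) :
    inner ℝ a (gramOperator W a) = (W *ᵥ WithLp.ofLp a) ⬝ᵥ (W *ᵥ WithLp.ofLp a) := by
  rw [← dotProduct_transpose_mulVec]
  simp only [PiLp.inner_apply, gramOperator_apply, dotProduct]
  simp [mul_comm]

/-- The adjoint of the pair `(A, C)` of the range observer is controllable if the steering Gramian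
is coercive, uniformly in time. -/
theorem adjointControllable_stateMatrix (W : Matrix (Fin l) (Fin n) ℝ)
    {u v g g' : ℝ → EuclideanSpace ℝ (Fin n)} {b b' : ℝ → ℝ} {δ ν B Bg Bb : ℝ}
    (hδ : 0 < δ) (hν : 0 < ν) (hv : Continuous v) (hvB : ∀ t, ‖v t‖ ≤ B)
    (huv : ∀ t, 0 ≤ t → v t = u t)
    (hg : ∀ t, HasDerivAt g (g' t) t) (hgB : ∀ t, ‖g t‖ ≤ Bg) (hgB' : ∀ t, ‖g' t‖ ≤ Bg)
    (hb : ∀ t, HasDerivAt b (b' t) t) (hb0 : b 0 = 0) (hbδ : b δ = 0)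
    (hb1 : ∀ t ∈ Icc 0 δ, |b t| ≤ 1) (hbB : ∀ t ∈ Icc 0 δ, |b' t| ≤ Bb)
    (hcoer : ∀ t₀, 0 ≤ t₀ → ∀ a,
      ν * ‖a‖ ^ 2 ≤ inner ℝ a (steeringGramian (gramOperator W) v g b δ t₀ a)) :
    AdjointControllable (fun t => stateMatrix (u t))
      (Matrix.fromBlocks 0 (Matrix.of fun _ _ => 1) W 0 : Matrix (OutIdx l) (StateIdx n) ℝ) := by
  obtain ⟨c, hc, hsteer⟩ := exists_steering hδ hν hv hvB hg hgB hgB' hb hb0 hbδ hb1 hbB hcoer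
  obtain ⟨cW, hcW, hW⟩ := exists_mulVec_dotProduct_le W
  refine ⟨δ, 4 * c ^ 2 * (1 + cW), hδ, by positivity, fun t₀ ht₀ x => ?_⟩
  set x₁ : EuclideanSpace ℝ (Fin n) := WithLp.toLp 2 fun i => x (Sum.inl i) with hx₁
  set x₂ : ℝ := x (Sum.inr ()) with hx₂
  obtain ⟨a, w₁, w₂, η, hw₁0, hw₂0, hw₁1, hw₂1, ha, hw⟩ := hsteer t₀ ht₀ x₁ x₂
  have hxx : x ⬝ᵥ x = ‖x₁‖ ^ 2 + x₂ ^ 2 := by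
    rw [norm_toLp_sq]
    simp [dotProduct, pow_two, hx₂]
  have hsq : ∀ y, |y| ≤ c * (‖x₁‖ + |x₂|) → y ^ 2 ≤ 2 * c ^ 2 * (x ⬝ᵥ x) := fun y hy => by
    have h1 := pow_le_pow_left₀ (abs_nonneg _) hy 2
    rw [sq_abs, mul_pow] at h1
    have h2 : (‖x₁‖ + |x₂|) ^ 2 ≤ 2 * (x ⬝ᵥ x) := by
      rw [hxx]
      nlinarith [sq_nonneg (‖x₁‖ - |x₂|), sq_abs x₂]
    nlinarith [sq_nonneg c]
  have hx0 := dotProduct_self_nonneg' x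
  have hp : 0 ≤ c ^ 2 * cW * (x ⬝ᵥ x) := by positivity
  refine ⟨fun s => Sum.elim (fun i => w₁ s i) (fun _ => w₂ s),
    fun s => Sum.elim (fun _ => η s) (W *ᵥ WithLp.ofLp a), ?_, ?_, fun s hs => ⟨?_, ?_, ?_⟩⟩
  · ext (i | i) <;> simp [hw₁0, hw₂0]
  · ext (i | i) <;> simp [hw₁1, hw₂1, hx₁, hx₂]
  · refine hasDerivWithinAt_pi.2 fun i => ?_
    obtain ⟨h1, h2, -⟩ := hw s hs
    rcases i with i | i
    · have h3 : HasDerivAt (fun s => w₁ s i) ((gramOperator W a - w₂ s • v s) i) s :=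
        (EuclideanSpace.proj (𝕜 := ℝ) i).hasFDerivAt.comp_hasDerivAt s h1
      refine (h3.congr_deriv ?_).hasDerivWithinAt
      rw [PiLp.sub_apply, gramOperator_apply, huv s (ht₀.trans hs.1)]
      simp [stateMatrix, Matrix.mulVec, dotProduct]
      ring
    · refine (h2.congr_deriv ?_).hasDerivWithinAt
      simp [stateMatrix, Matrix.mulVec, dotProduct]
  · obtain ⟨-, -, h3, h4, -⟩ := hw s hs
    have h5 := hsq ‖w₁ s‖ (by rwa [abs_norm])
    have h6 := hsq (w₂ s) h4
    rw [EuclideanSpace.real_norm_sq_eq] at h5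
    have h7 : (Sum.elim (fun i => w₁ s i) (fun _ => w₂ s) : StateIdx n → ℝ) ⬝ᵥ
        Sum.elim (fun i => w₁ s i) (fun _ => w₂ s) = ∑ i, w₁ s i ^ 2 + w₂ s ^ 2 := by
      simp [dotProduct, pow_two]
    rw [h7]
    linarith
  · obtain ⟨-, -, -, -, h5⟩ := hw s hs
    have h6 := hsq (η s) h5
    have h7 : (Sum.elim (fun _ => η s) (W *ᵥ WithLp.ofLp a) : OutIdx l → ℝ) ⬝ᵥ
        Sum.elim (fun _ => η s) (W *ᵥ WithLp.ofLp a)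
          = η s ^ 2 + (W *ᵥ WithLp.ofLp a) ⬝ᵥ (W *ᵥ WithLp.ofLp a) := by
      simp [dotProduct, pow_two]
    have h8 := hsq ‖a‖ (by rwa [abs_norm])
    have h9 := hW (WithLp.ofLp a)
    rw [← norm_toLp_sq (WithLp.ofLp a), WithLp.toLp_ofLp] at h9
    have h11 : 0 ≤ c ^ 2 * (x ⬝ᵥ x) := by positivity
    have h10 := mul_le_mul_of_nonneg_left h8 hcW
    rw [h7]
    nlinarith

end Controllability

section Approximation

/-- A smooth profile on `[0, δ]` which vanishes at the endpoints and is close to `1` in mean. -/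
lemma exists_profile {δ ω : ℝ} (hδ : 0 < δ) (hω : 0 < ω) :
    ∃ (b b' : ℝ → ℝ) (Bb : ℝ), (∀ t, HasDerivAt b (b' t) t) ∧ b 0 = 0 ∧ b δ = 0 ∧
      (∀ t ∈ Icc 0 δ, 0 ≤ b t ∧ b t ≤ 1) ∧ (∀ t ∈ Icc 0 δ, |b' t| ≤ Bb) ∧
      ∫ t in (0 : ℝ)..δ, (1 - b t) ≤ ω := by
  obtain ⟨N, hN⟩ := exists_nat_gt (δ / ω)
  have hN0 : (0 : ℝ) < N := (div_pos hδ hω).trans hN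
  have hlin : ∀ t, HasDerivAt (fun t => 2 * t / δ - 1) (2 / δ) t := fun t => by
    simpa using (((hasDerivAt_id t).const_mul 2).div_const δ).sub_const 1
  have hcont : Continuous fun t : ℝ =>
      -(((2 * N : ℕ) : ℝ) * (2 * t / δ - 1) ^ (2 * N - 1) * (2 / δ)) := by fun_prop
  obtain ⟨Bb, hBb⟩ := (isCompact_Icc (a := 0) (b := δ)).exists_bound_of_continuousOn
    hcont.continuousOn
  refine ⟨fun t => 1 - (2 * t / δ - 1) ^ (2 * N), _, Bb,
    fun t => ((hlin t).fun_pow (2 * N)).const_sub 1, by simp, by field_simp; norm_num,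
    fun t ht => ⟨?_, ?_⟩, hBb, ?_⟩
  · have h1 : |2 * t / δ - 1| ≤ 1 := by
      rw [abs_le]
      have h2 : 2 * t / δ ≤ 2 := by rw [div_le_iff₀ hδ]; linarith [ht.2]
      have h3 : 0 ≤ 2 * t / δ := div_nonneg (by linarith [ht.1]) hδ.le
      constructor <;> linarith
    have h2 := pow_le_one₀ (n := 2 * N) (abs_nonneg _) h1
    rw [pow_mul, sq_abs, ← pow_mul] at h2
    linarith
  · have : 0 ≤ (2 * t / δ - 1) ^ (2 * N) := by rw [pow_mul]; positivity
    linarith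
  · have hprim : ∀ t ∈ uIcc 0 δ, HasDerivAt
        (fun t => δ / (2 * ((2 * N + 1 : ℕ) : ℝ)) * (2 * t / δ - 1) ^ (2 * N + 1))
        (1 - (1 - (2 * t / δ - 1) ^ (2 * N))) t := fun t _ => by
      refine (((hlin t).fun_pow (2 * N + 1)).const_mul _).congr_deriv ?_
      have : ((2 * N + 1 : ℕ) : ℝ) ≠ 0 := by positivity
      rw [Nat.add_sub_cancel]
      field_simp
      ring
    rw [intervalIntegral.integral_eq_sub_of_hasDerivAt hprim
      ((by fun_prop : Continuous fun t : ℝ =>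
        1 - (1 - (2 * t / δ - 1) ^ (2 * N))).intervalIntegrable _ _)]
    have h1 : 2 * δ / δ - 1 = 1 := by field_simp; norm_num
    have h2 : (2 * 0 / δ - 1) ^ (2 * N + 1) = -1 := by simp [pow_succ, pow_mul]
    rw [h1, h2, one_pow, mul_one, mul_neg_one, sub_neg_eq_add, ← mul_two, div_mul_eq_mul_div,
      mul_comm 2 (((2 * N + 1 : ℕ) : ℝ)), mul_div_mul_right _ _ two_ne_zero,
      div_le_iff₀ (by positivity)]
    rw [div_lt_iff₀ hω] at hN
    push_cast
    nlinarith

/-- A bounded uniformly continuous function is uniformly close to one with bounded derivative. -/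
lemma exists_differentiable_approx {E : Type*} [NormedAddCommGroup E] [NormedSpace ℝ E]
    [CompleteSpace E] {v : ℝ → E} (hv : UniformContinuous v) {B ω : ℝ} (hB : ∀ t, ‖v t‖ ≤ B)
    (hω : 0 < ω) :
    ∃ (g g' : ℝ → E) (Bg : ℝ), (∀ t, HasDerivAt g (g' t) t) ∧ (∀ t, ‖g t‖ ≤ Bg) ∧
      (∀ t, ‖g' t‖ ≤ Bg) ∧ ∀ t, ‖g t - v t‖ ≤ ω := by
  obtain ⟨h', hh', hvh⟩ := Metric.uniformContinuous_iff.1 hv ω hω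
  obtain ⟨h, hh, hhh'⟩ := exists_between hh'
  have hvc := hv.continuous
  have hB0 : 0 ≤ B := (norm_nonneg _).trans (hB 0)
  set F : ℝ → E := fun t => ∫ τ in (0 : ℝ)..t, v τ with hF
  have hFd : ∀ t, HasDerivAt F (v t) t := fun t => (hvc.integral_hasStrictDerivAt 0 t).hasDerivAt
  have happrox : ∀ t, ‖h⁻¹ • (F (t + h) - F t) - v t‖ ≤ ω := fun t => by
    have h1 : h⁻¹ • (F (t + h) - F t) - v t = h⁻¹ • ∫ τ in t..(t + h), (v τ - v t) := by
      rw [intervalIntegral.integral_sub (hvc.intervalIntegrable _ _)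
        (continuous_const.intervalIntegrable _ _), intervalIntegral.integral_const,
        add_sub_cancel_left, smul_sub _ _ (h • v t), inv_smul_smul₀ hh.ne', hF,
        intervalIntegral.integral_interval_sub_left (hvc.intervalIntegrable _ _)
          (hvc.intervalIntegrable _ _)]
    have h2 : ‖∫ τ in t..(t + h), (v τ - v t)‖ ≤ ω * |t + h - t| := by
      refine intervalIntegral.norm_integral_le_of_norm_le_const fun τ hτ => ?_
      rw [uIoc_of_le (by linarith)] at hτ
      rw [← dist_eq_norm]
      refine (hvh ?_).le
      rw [Real.dist_eq, abs_of_pos (by linarith [hτ.1])]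
      linarith [hτ.2]
    rw [add_sub_cancel_left, abs_of_pos hh] at h2
    rw [h1, norm_smul, norm_inv, Real.norm_eq_abs, abs_of_pos hh, inv_mul_le_iff₀ hh]
    linarith
  refine ⟨fun t => h⁻¹ • (F (t + h) - F t), fun t => h⁻¹ • (v (t + h) - v t),
    B + ω + h⁻¹ * (B + B), fun t => ?_, fun t => ?_, fun t => ?_, happrox⟩
  · exact (((hFd (t + h)).comp_add_const t h).sub (hFd t)).const_smul h⁻¹
  · have h1 := norm_le_norm_add_norm_sub' (h⁻¹ • (F (t + h) - F t)) (v t)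
    have h2 : 0 ≤ h⁻¹ * (B + B) := by positivity
    linarith [hB t, happrox t]
  · rw [norm_smul, norm_inv, Real.norm_eq_abs, abs_of_pos hh]
    have h1 := mul_le_mul_of_nonneg_left ((norm_sub_le (v (t + h)) (v t)).trans
      (add_le_add (hB (t + h)) (hB t))) (inv_nonneg.2 hh.le)
    linarith

end Approximation

section Excitation

variable {n l : ℕ}

lemma form_integral_outer {u : ℝ → EuclideanSpace ℝ (Fin n)} {t₀ t₁ : ℝ}
    (hu : ContinuousOn u (uIcc t₀ t₁)) (a : EuclideanSpace ℝ (Fin n)) :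
    WithLp.ofLp a ⬝ᵥ ((Matrix.of fun i j => ∫ s in t₀..t₁, u s i * u s j) *ᵥ WithLp.ofLp a) =
      ∫ s in t₀..t₁, (inner ℝ (u s) a : ℝ) ^ 2 := by
  have hc : ∀ i, ContinuousOn (fun s => u s i) (uIcc t₀ t₁) := fun i =>
    (EuclideanSpace.proj (𝕜 := ℝ) i).continuous.comp_continuousOn hu
  have hcij : ∀ i j, ContinuousOn (fun s => a i * (u s i * u s j * a j)) (uIcc t₀ t₁) :=
    fun i j => continuousOn_const.mul (((hc i).mul (hc j)).mul continuousOn_const)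
  have h1 : ∀ s, (inner ℝ (u s) a : ℝ) ^ 2 = ∑ i, ∑ j, a i * (u s i * u s j * a j) := fun s => by
    rw [pow_two, PiLp.inner_apply, Finset.sum_mul_sum]
    refine Finset.sum_congr rfl fun i _ => Finset.sum_congr rfl fun j _ => ?_
    simp
    ring
  simp only [h1]
  rw [intervalIntegral.integral_finsetSum fun i _ =>
    (continuousOn_finsetSum _ fun j _ => hcij i j).intervalIntegrable]
  simp only [dotProduct, Matrix.mulVec, Finset.mul_sum, Matrix.of_apply]
  refine Finset.sum_congr rfl fun i _ => ?_
  rw [intervalIntegral.integral_finsetSum fun j _ => (hcij i j).intervalIntegrable]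
  refine Finset.sum_congr rfl fun j _ => ?_
  rw [intervalIntegral.integral_const_mul, intervalIntegral.integral_mul_const]

/-- The quadratic form of the matrix in the excitation condition. -/
lemma form_excitation (z : Fin l → EuclideanSpace ℝ (Fin n)) (α : Fin l → ℝ)
    {u : ℝ → EuclideanSpace ℝ (Fin n)} (hu : ContinuousOn u (Ici 0)) {t δ : ℝ} (ht : 0 ≤ t)
    (hδ : 0 < δ) (a : EuclideanSpace ℝ (Fin n)) :
    WithLp.ofLp a ⬝ᵥ ((sourceMatrix z * (weightMatrix α)ᵀ * weightMatrix α * (sourceMatrix z)ᵀ +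
      (1 / δ) • (Matrix.of fun i j => ∫ s in t..(t + δ), u s i * u s j)) *ᵥ WithLp.ofLp a) =
    ((weightMatrix α * (sourceMatrix z)ᵀ) *ᵥ WithLp.ofLp a) ⬝ᵥ
      ((weightMatrix α * (sourceMatrix z)ᵀ) *ᵥ WithLp.ofLp a) +
      1 / δ * ∫ s in t..(t + δ), (inner ℝ (u s) a : ℝ) ^ 2 := by
  have hsub : uIcc t (t + δ) ⊆ Ici 0 := by
    rw [uIcc_of_le (by linarith)]
    exact fun s hs => ht.trans hs.1
  have h1 : sourceMatrix z * (weightMatrix α)ᵀ * weightMatrix α * (sourceMatrix z)ᵀ =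
      (weightMatrix α * (sourceMatrix z)ᵀ)ᵀ * (weightMatrix α * (sourceMatrix z)ᵀ) := by
    rw [Matrix.transpose_mul, Matrix.transpose_transpose]
    simp only [Matrix.mul_assoc]
  rw [Matrix.add_mulVec, dotProduct_add, Matrix.smul_mulVec, dotProduct_smul, smul_eq_mul,
    form_integral_outer (hu.mono hsub), h1, ← Matrix.mulVec_mulVec, dotProduct_transpose_mulVec]

lemma isHermitian_excitation (z : Fin l → EuclideanSpace ℝ (Fin n)) (α : Fin l → ℝ)
    (u : ℝ → EuclideanSpace ℝ (Fin n)) (t δ μ : ℝ) :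
    (sourceMatrix z * (weightMatrix α)ᵀ * weightMatrix α * (sourceMatrix z)ᵀ +
      (1 / δ) • (Matrix.of fun i j => ∫ s in t..(t + δ), u s i * u s j) -
      μ • (1 : Matrix (Fin n) (Fin n) ℝ)).IsHermitian := by
  have h1 : (Matrix.of fun i j => ∫ s in t..(t + δ), u s i * u s j)ᵀ =
      Matrix.of fun i j => ∫ s in t..(t + δ), u s i * u s j := by
    ext i j
    simp only [Matrix.transpose_apply, Matrix.of_apply, mul_comm]
  rw [Matrix.IsHermitian, Matrix.conjTranspose_eq_transpose_of_trivial]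
  simp only [Matrix.transpose_sub, Matrix.transpose_add, Matrix.transpose_smul, h1,
    Matrix.transpose_mul, Matrix.transpose_transpose, Matrix.transpose_one, Matrix.mul_assoc]

lemma exists_le_form_of_rank_eq {W : Matrix (Fin l) (Fin n) ℝ} (hW : W.rank = n) :
    ∃ μ : ℝ, 0 < μ ∧ ∀ x : Fin n → ℝ, μ * (x ⬝ᵥ x) ≤ (W *ᵥ x) ⬝ᵥ (W *ᵥ x) := by
  have hinj : Function.Injective W.mulVec := by
    have h1 := W.mulVecLin.finrank_range_add_finrank_ker
    rw [← Matrix.rank, hW, Module.finrank_fin_fun] at h1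
    have h2 : Module.finrank ℝ (LinearMap.ker W.mulVecLin) = 0 := by omega
    have h3 := LinearMap.ker_eq_bot.1 (Submodule.finrank_eq_zero.1 h2)
    exact h3
  have hpd : (Wᵀ * W).PosDef := Matrix.PosDef.conjTranspose_mul_self W hinj
  obtain ⟨c, hc0, hc⟩ := exists_form_le_on_Icc (M := fun _ => (Wᵀ * W)⁻¹) (a := 0) (b := 0)
    continuousOn_const
  have h0 : (0 : ℝ) ∈ Icc (0 : ℝ) 0 := ⟨le_rfl, le_rfl⟩
  refine ⟨(c + 1)⁻¹, by positivity, fun x => ?_⟩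
  have h1 := dotProduct_self_le_mul_inv_form hpd.inv (p := c + 1) (by positivity)
    (fun x => (hc 0 h0 x).trans
      (mul_le_mul_of_nonneg_right (by linarith) (dotProduct_self_nonneg' x))) x
  rw [Matrix.nonsing_inv_nonsing_inv _ hpd.det_pos.ne'.isUnit, ← Matrix.mulVec_mulVec,
    dotProduct_transpose_mulVec] at h1
  rw [inv_mul_le_iff₀ (by positivity)]
  exact h1

/-- If `D(α) Zᵀ` has full rank then every continuous velocity is persistently exciting. -/
theorem exists_persistentlyExciting_of_rank_eq (z : Fin l → EuclideanSpace ℝ (Fin n))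
    (α : Fin l → ℝ) (hrank : (weightMatrix α * (sourceMatrix z)ᵀ).rank = n) :
    ∃ μ : ℝ, 0 < μ ∧ ∀ v : ℝ → EuclideanSpace ℝ (Fin n), ContinuousOn v (Ici 0) →
      ∀ δ : ℝ, 0 < δ → PersistentlyExciting z α v δ μ := by
  obtain ⟨μ, hμ, hW⟩ := exists_le_form_of_rank_eq hrank
  refine ⟨μ, hμ, fun v hv δ hδ t ht => ?_⟩
  refine Matrix.PosSemidef.of_dotProduct_mulVec_nonneg (isHermitian_excitation z α v t δ μ)
    fun x => ?_
  have h1 := form_excitation z α hv ht hδ (WithLp.toLp 2 x)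
  rw [WithLp.ofLp_toLp] at h1
  have h2 : 0 ≤ ∫ s in t..(t + δ), (inner ℝ (v s) (WithLp.toLp 2 x) : ℝ) ^ 2 :=
    intervalIntegral.integral_nonneg (by linarith) fun _ _ => sq_nonneg _
  have h3 : 0 ≤ 1 / δ * ∫ s in t..(t + δ), (inner ℝ (v s) (WithLp.toLp 2 x) : ℝ) ^ 2 := by
    positivity
  rw [star_trivial, Matrix.sub_mulVec, dotProduct_sub, h1, Matrix.smul_mulVec, Matrix.one_mulVec,
    dotProduct_smul, smul_eq_mul]
  linarith [hW x]

end Excitation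

section Observability

variable {n l : ℕ}

lemma exists_extension {u : ℝ → EuclideanSpace ℝ (Fin n)} (hu : ContinuousOn u (Ici 0))
    (hub : ∃ B : ℝ, ∀ t, 0 ≤ t → ‖u t‖ ≤ B) :
    ∃ (v : ℝ → EuclideanSpace ℝ (Fin n)) (B : ℝ), Continuous v ∧ (∀ t, ‖v t‖ ≤ B) ∧
      (∀ t, 0 ≤ t → v t = u t) ∧ (UniformContinuousOn u (Ici 0) → UniformContinuous v) := by
  obtain ⟨B, hB⟩ := hub
  have hmax : ∀ t : ℝ, 0 ≤ max t 0 := fun t => le_max_right t 0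
  refine ⟨fun t => u (max t 0), B, ?_, fun t => hB _ (hmax t), fun t ht => by simp [ht],
    fun h => ?_⟩
  · exact hu.comp_continuous (by fun_prop) hmax
  · have h1 : LipschitzWith 1 fun t : ℝ => max t 0 := LipschitzWith.id.max_const 0
    rw [← uniformContinuousOn_univ]
    exact h.comp h1.uniformContinuous.uniformContinuousOn fun t _ => hmax t

/-- Under full rank of `D(α) Zᵀ` the range observer is uniformly observable. -/
theorem adjointControllable_of_rank_eq (z : Fin l → EuclideanSpace ℝ (Fin n)) (α : Fin l → ℝ)
    {u : ℝ → EuclideanSpace ℝ (Fin n)} (hu : ContinuousOn u (Ici 0))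
    (hub : ∃ B : ℝ, ∀ t, 0 ≤ t → ‖u t‖ ≤ B)
    (hrank : (weightMatrix α * (sourceMatrix z)ᵀ).rank = n) :
    AdjointControllable (fun t => stateMatrix (u t)) (outputMatrix z α) := by
  obtain ⟨v, B, hv, hvB, hvu, -⟩ := exists_extension hu hub
  obtain ⟨μ, hμ, hW⟩ := exists_le_form_of_rank_eq hrank
  refine adjointControllable_stateMatrix (g := fun _ => 0) (g' := fun _ => 0) (b := fun _ => 0)
    (b' := fun _ => 0) (Bg := 0) (Bb := 0) _ one_pos hμ hv hvB hvu
    (fun t => hasDerivAt_const t _) (by simp) (by simp) (fun t => hasDerivAt_const t _) rfl rfl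
    (by simp) (by simp) fun t₀ _ a => ?_
  rw [inner_steeringGramian hv continuous_const continuous_const, inner_gramOperator]
  have := hW (WithLp.ofLp a)
  rw [← norm_toLp_sq (WithLp.ofLp a), WithLp.toLp_ofLp] at this
  simpa using this

/-- Under persistent excitation by a uniformly continuous velocity the range observer is uniformly
observable. -/
theorem adjointControllable_of_persistentlyExciting (z : Fin l → EuclideanSpace ℝ (Fin n))
    (α : Fin l → ℝ) {u : ℝ → EuclideanSpace ℝ (Fin n)} (hu : UniformContinuousOn u (Ici 0))
    (hub : ∃ B : ℝ, ∀ t, 0 ≤ t → ‖u t‖ ≤ B) {δ μ : ℝ} (hδ : 0 < δ) (hμ : 0 < μ)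
    (hPE : PersistentlyExciting z α u δ μ) :
    AdjointControllable (fun t => stateMatrix (u t)) (outputMatrix z α) := by
  obtain ⟨v, B, hv, hvB, hvu, hvuc⟩ := exists_extension hu.continuousOn hub
  have hB : 0 ≤ B := (norm_nonneg _).trans (hvB 0)
  have hω : 0 < μ / (4 * (B + 1)) := by positivity
  have hκ : 0 < δ * μ / (4 * (B ^ 2 + 1)) := by positivity
  obtain ⟨g, g', Bg, hg, hgB, hgB', hgv⟩ := exists_differentiable_approx (hvuc hu) hvB hω
  obtain ⟨b, b', Bb, hb, hb0, hbδ, hb1, hbB, hbint⟩ := exists_profile hδ hκ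
  have hgc : Continuous g := continuous_iff_continuousAt.2 fun t => (hg t).continuousAt
  have hbc : Continuous b := continuous_iff_continuousAt.2 fun t => (hb t).continuousAt
  refine adjointControllable_stateMatrix (ν := δ * μ / 2) _ hδ (by positivity) hv hvB hvu hg hgB
    hgB' hb hb0 hbδ (fun t ht => abs_le.2 ⟨by linarith [(hb1 t ht).1], (hb1 t ht).2⟩) hbB
    fun t₀ ht₀ a => ?_
  rw [inner_steeringGramian hv hgc hbc, inner_gramOperator]
  set W := weightMatrix α * (sourceMatrix z)ᵀ with hWdef
  have hPEa := le_form_of_posSemidef (hPE t₀ ht₀) (WithLp.ofLp a)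
  rw [form_excitation z α hu.continuousOn ht₀ hδ a, ← norm_toLp_sq (WithLp.ofLp a),
    WithLp.toLp_ofLp] at hPEa
  have hle : t₀ ≤ t₀ + δ := by linarith
  have huv : ∫ s in t₀..(t₀ + δ), (inner ℝ (u s) a : ℝ) ^ 2 =
      ∫ s in t₀..(t₀ + δ), (inner ℝ (v s) a : ℝ) ^ 2 := by
    refine intervalIntegral.integral_congr fun s hs => ?_
    rw [uIcc_of_le hle] at hs
    simp only [hvu s (ht₀.trans hs.1)]
  rw [huv, ← hWdef] at hPEa
  obtain ⟨ω, hωdef⟩ : ∃ ω, ω = μ / (4 * (B + 1)) := ⟨_, rfl⟩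
  rw [← hωdef] at hgv
  have hpoint : ∀ s ∈ Icc t₀ (t₀ + δ),
      (inner ℝ (v s) a : ℝ) ^ 2 - B ^ 2 * ‖a‖ ^ 2 * (1 - b (s - t₀)) - ω * B * ‖a‖ ^ 2 ≤
        b (s - t₀) * inner ℝ (g s) a * inner ℝ (v s) a := fun s hs => by
    obtain ⟨hbs0, hbs1⟩ := hb1 (s - t₀) ⟨sub_nonneg.2 hs.1, by linarith [hs.2]⟩
    have hva : |(inner ℝ (v s) a : ℝ)| ≤ B * ‖a‖ := (abs_real_inner_le_norm _ _).trans
      (mul_le_mul_of_nonneg_right (hvB s) (norm_nonneg _))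
    have hda : |(inner ℝ (g s - v s) a : ℝ)| ≤ ω * ‖a‖ := (abs_real_inner_le_norm _ _).trans
      (mul_le_mul_of_nonneg_right (hgv s) (norm_nonneg _))
    have h1 : (inner ℝ (v s) a : ℝ) ^ 2 ≤ B ^ 2 * ‖a‖ ^ 2 := by
      rw [← sq_abs, ← mul_pow]
      exact pow_le_pow_left₀ (abs_nonneg _) hva 2
    have h2 : |b (s - t₀) * inner ℝ (g s - v s) a * inner ℝ (v s) a| ≤
        1 * (ω * ‖a‖) * (B * ‖a‖) := by
      rw [abs_mul, abs_mul, abs_of_nonneg hbs0]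
      exact mul_le_mul (mul_le_mul hbs1 hda (abs_nonneg _) zero_le_one) hva (abs_nonneg _)
        (mul_nonneg zero_le_one ((abs_nonneg _).trans hda))
    have h3 := mul_le_mul_of_nonneg_right h1 (sub_nonneg.2 hbs1)
    have h4 := (abs_le.1 h2).1
    rw [inner_sub_left] at h4
    nlinarith
  have hc1 : Continuous fun s => (inner ℝ (v s) a : ℝ) ^ 2 := by fun_prop
  have hc2 : Continuous fun s => B ^ 2 * ‖a‖ ^ 2 * (1 - b (s - t₀)) := by fun_prop
  have hc3 : Continuous fun s => b (s - t₀) * inner ℝ (g s) a * inner ℝ (v s) a := by fun_prop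
  have hc12 : Continuous fun s => (inner ℝ (v s) a : ℝ) ^ 2 -
    B ^ 2 * ‖a‖ ^ 2 * (1 - b (s - t₀)) := hc1.sub hc2
  have hc123 : Continuous fun s => (inner ℝ (v s) a : ℝ) ^ 2 -
    B ^ 2 * ‖a‖ ^ 2 * (1 - b (s - t₀)) - ω * B * ‖a‖ ^ 2 := hc12.sub continuous_const
  have hmono := intervalIntegral.integral_mono_on (μ := MeasureTheory.volume) hle
    (hc123.intervalIntegrable _ _) (hc3.intervalIntegrable _ _) hpoint
  rw [intervalIntegral.integral_sub (hc12.intervalIntegrable _ _)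
      (continuous_const.intervalIntegrable _ _),
    intervalIntegral.integral_sub (hc1.intervalIntegrable _ _) (hc2.intervalIntegrable _ _),
    intervalIntegral.integral_const, intervalIntegral.integral_const_mul,
    intervalIntegral.integral_comp_sub_right (fun s => 1 - b s), sub_self, add_sub_cancel_left,
    smul_eq_mul] at hmono
  have ha := sq_nonneg ‖a‖
  have h1 : B ^ 2 * ∫ s in (0 : ℝ)..δ, (1 - b s) ≤ δ * μ / 4 := by
    refine (mul_le_mul_of_nonneg_left hbint (sq_nonneg B)).trans ?_
    rw [← mul_div_assoc, div_le_div_iff₀ (by positivity) (by norm_num)]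
    nlinarith [mul_pos hδ hμ]
  have h2 : ω * B ≤ μ / 4 := by
    rw [hωdef, div_mul_eq_mul_div, div_le_div_iff₀ (by positivity) (by norm_num)]
    nlinarith
  have h3 := mul_le_mul_of_nonneg_right h1 ha
  have h4 := mul_le_mul_of_nonneg_right (mul_le_mul_of_nonneg_left h2 hδ.le) ha
  have h5 := mul_le_mul_of_nonneg_left hPEa hδ.le
  rw [mul_add, ← mul_assoc δ (1 / δ), mul_one_div_cancel hδ.ne', one_mul] at h5
  nlinarith

end Observability

section Sources

variable {n l : ℕ}

lemma weightMatrix_mul_sourceMatrix_mulVec (z : Fin l → EuclideanSpace ℝ (Fin n)) (α : Fin l → ℝ)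
    (x : EuclideanSpace ℝ (Fin n)) (j : Fin l) :
    ((weightMatrix α * (sourceMatrix z)ᵀ) *ᵥ WithLp.ofLp x) j =
      ∑ i, α i * inner ℝ (z i) x - inner ℝ (z j) x := by
  have h1 : ∀ i, ((sourceMatrix z)ᵀ *ᵥ WithLp.ofLp x) i = inner ℝ (z i) x := fun i => by
    simp [sourceMatrix, Matrix.mulVec, dotProduct, PiLp.inner_apply, mul_comm]
  rw [← Matrix.mulVec_mulVec, weightMatrix, Matrix.sub_mulVec, Matrix.one_mulVec, Pi.sub_apply, h1]
  simp only [Matrix.mulVec, dotProduct, Matrix.vecMulVec_apply, one_mul] at h1 ⊢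
  simp only [h1]

/-- If `n + 1` source points are affinely independent then `D(α) Zᵀ` has full rank. -/
theorem rank_eq_of_affineIndependent (z : Fin l → EuclideanSpace ℝ (Fin n)) (α : Fin l → ℝ)
    {f : Fin (n + 1) → Fin l} (hf : AffineIndependent ℝ (fun i => z (f i))) :
    (weightMatrix α * (sourceMatrix z)ᵀ).rank = n := by
  have hspan : vectorSpan ℝ (range fun i => z (f i)) = ⊤ :=
    hf.vectorSpan_eq_top_of_card_eq_finrank_add_one (by simp)
  have hker : LinearMap.ker (weightMatrix α * (sourceMatrix z)ᵀ).mulVecLin = ⊥ := by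
    refine (Submodule.eq_bot_iff _).2 fun x hx => ?_
    have h1 : ∀ j, inner ℝ (z j) (WithLp.toLp 2 x) =
        ∑ i, α i * (inner ℝ (z i) (WithLp.toLp 2 x) : ℝ) := fun j => by
      have h2 := weightMatrix_mul_sourceMatrix_mulVec z α (WithLp.toLp 2 x) j
      have h3 := congrFun (LinearMap.mem_ker.1 hx) j
      rw [Matrix.mulVecLin_apply] at h3
      rw [WithLp.ofLp_toLp, h3, Pi.zero_apply] at h2
      linarith
    have h4 : ∀ y ∈ vectorSpan ℝ (range fun i => z (f i)),
        (inner ℝ y (WithLp.toLp 2 x) : ℝ) = 0 := fun y hy => by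
      rw [vectorSpan_def] at hy
      induction hy using Submodule.span_induction with
      | mem y hy =>
        obtain ⟨_, ⟨i, rfl⟩, _, ⟨j, rfl⟩, rfl⟩ := hy
        simp only [vsub_eq_sub, inner_sub_left]
        rw [h1 (f i), h1 (f j), sub_self]
      | zero => exact inner_zero_left _
      | add y₁ y₂ _ _ h₁ h₂ => rw [inner_add_left, h₁, h₂, add_zero]
      | smul c y _ h => rw [inner_smul_left, h, mul_zero]
    have h5 := h4 (WithLp.toLp 2 x) (hspan ▸ Submodule.mem_top)
    rw [inner_self_eq_zero] at h5
    simpa using congrArg WithLp.ofLp h5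
  have h1 := (weightMatrix α * (sourceMatrix z)ᵀ).mulVecLin.finrank_range_add_finrank_ker
  rw [hker, finrank_bot, add_zero, Module.finrank_fin_fun] at h1
  exact h1

end Sources

section ErrorDynamics

variable {n l : ℕ} {z : Fin l → EuclideanSpace ℝ (Fin n)} {α : Fin l → ℝ}

lemma hasDerivWithinAt_weightedOutput (hα : ∑ i, α i = 1)
    {x : ℝ → EuclideanSpace ℝ (Fin n)} {v : EuclideanSpace ℝ (Fin n)} {s : Set ℝ} {t : ℝ}
    (hx : HasDerivWithinAt x v s t) :
    HasDerivWithinAt (fun t => weightedOutput z α (x t))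
      (inner ℝ (x t) v - ∑ i, α i * inner ℝ (z i) v) s t := by
  have h : HasDerivWithinAt (fun t => weightedOutput z α (x t))
      (∑ i, α i * (1 / 2 * (2 * inner ℝ (x t - z i) v))) s t :=
    HasDerivWithinAt.fun_sum fun i _ =>
      (((hx.sub_const (z i)).norm_sq.const_mul (1 / 2)).sub_const _).const_mul (α i)
  refine h.congr_deriv ?_
  have h1 : ∀ i, α i * (1 / 2 * (2 * inner ℝ (x t - z i) v)) =
      α i * inner ℝ (x t) v - α i * (inner ℝ (z i) v : ℝ) := fun i => by
    rw [inner_sub_left]; ring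
  simp only [h1, Finset.sum_sub_distrib, ← Finset.sum_mul, hα, one_mul]

/-- The augmented state obeys `Ẋ = A X + ū`. -/
lemma hasDerivWithinAt_augmentedState (hα : ∑ i, α i = 1)
    {x : ℝ → EuclideanSpace ℝ (Fin n)} {v : EuclideanSpace ℝ (Fin n)} {s : Set ℝ} {t : ℝ}
    (hx : HasDerivWithinAt x v s t) :
    HasDerivWithinAt (fun t => augmentedState z α (x t))
      (stateMatrix v *ᵥ augmentedState z α (x t) + augmentedInput z α v) s t := by
  refine hasDerivWithinAt_pi.2 fun i => ?_
  rcases i with i | i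
  · have h : HasDerivWithinAt (fun t => x t i) (v i) s t :=
      (EuclideanSpace.proj (𝕜 := ℝ) i).hasFDerivAt.comp_hasDerivWithinAt t hx
    refine h.congr_deriv ?_
    simp [stateMatrix, augmentedInput, Matrix.mulVec, dotProduct]
  · refine (hasDerivWithinAt_weightedOutput hα hx).congr_deriv ?_
    simp [stateMatrix, augmentedInput, augmentedState, Matrix.mulVec, dotProduct,
      PiLp.inner_apply, sub_eq_add_neg, mul_comm]

/-- The measured output is `y = C X`. -/
lemma measuredOutput_eq (hα : ∑ i, α i = 1) (x : EuclideanSpace ℝ (Fin n)) :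
    measuredOutput z α x = outputMatrix z α *ᵥ augmentedState z α x := by
  have hw : weightedOutput z α x = 1 / 2 * ‖x‖ ^ 2 - ∑ i, α i * inner ℝ (z i) x := by
    have h1 : ∀ i, α i * (rangeOutput z x i - 1 / 2 * ‖z i‖ ^ 2) =
        α i * (1 / 2 * ‖x‖ ^ 2) - α i * inner ℝ (z i) x := fun i => by
      rw [rangeOutput, norm_sub_sq_real, real_inner_comm x]; ring
    simp only [weightedOutput, h1, Finset.sum_sub_distrib, ← Finset.sum_mul, hα, one_mul]
  funext i
  rcases i with i | j
  · simp [measuredOutput, outputMatrix, augmentedState, Matrix.mulVec, dotProduct]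
  · have h1 : (outputMatrix z α *ᵥ augmentedState z α x) (Sum.inr j) =
        ((weightMatrix α * (sourceMatrix z)ᵀ) *ᵥ WithLp.ofLp x) j := by
      simp [outputMatrix, augmentedState, Matrix.mulVec, dotProduct]
    rw [h1, weightMatrix_mul_sourceMatrix_mulVec]
    simp only [measuredOutput, Sum.elim_inr]
    rw [hw, rangeOutput, norm_sub_sq_real, real_inner_comm x]
    ring

/-- The Riccati observer stabilizes the error as soon as the adjoint system is controllable. -/
theorem riccatiObserverStabilizes_of_adjointControllable (hα : ∑ i, α i = 1)
    {u : ℝ → EuclideanSpace ℝ (Fin n)} (hu : ContinuousOn u (Ici 0))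
    (hub : ∃ B : ℝ, ∀ t, 0 ≤ t → ‖u t‖ ≤ B)
    {k : ℝ → ℝ} (hk : ContinuousOn k (Ici 0)) (hk' : ∀ t, 0 ≤ t → 1 / 2 ≤ k t)
    {Q : ℝ → Matrix (OutIdx l) (OutIdx l) ℝ} (hQ : IsAdmissibleWeight Q)
    {V : ℝ → Matrix (StateIdx n) (StateIdx n) ℝ} (hV : IsAdmissibleWeight V)
    {P₀ : Matrix (StateIdx n) (StateIdx n) ℝ} (hP₀ : P₀.PosDef)
    (hctrl : AdjointControllable (fun t => stateMatrix (u t)) (outputMatrix z α)) :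
    RiccatiObserverStabilizes z α u k Q V P₀ := by
  obtain ⟨B, hB⟩ := hub
  obtain ⟨hQc, ⟨q, hq, hQq⟩, cQ, hQQ⟩ := hQ
  obtain ⟨hVc, ⟨v, hv, hVv⟩, cV, hVV⟩ := hV
  have hpsd : ∀ {ι : Type} [Fintype ι] [DecidableEq ι] {M : Matrix ι ι ℝ} {r : ℝ}, 0 < r →
      (M - r • (1 : Matrix ι ι ℝ)).PosSemidef → M.PosSemidef := fun hr h => by
    simpa using h.add (Matrix.PosSemidef.one.smul hr.le)
  have hQp : ∀ t, 0 ≤ t → (Q t).PosSemidef := fun t ht => hpsd hq (hQq t ht)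
  have hVp : ∀ t, 0 ≤ t → (V t).PosSemidef := fun t ht => hpsd hv (hVv t ht)
  have hAc : ContinuousOn (fun t => stateMatrix (u t)) (Ici 0) := by
    refine continuousOn_pi.2 fun i => continuousOn_pi.2 fun j => ?_
    rcases i with i | i <;> rcases j with j | j
    · exact continuousOn_const
    · exact continuousOn_const
    · exact (EuclideanSpace.proj (𝕜 := ℝ) j).continuous.comp_continuousOn hu
    · exact continuousOn_const
  set C := outputMatrix z α with hC
  obtain ⟨P, hP, hPpos⟩ := exists_isCRESolution_posDef (C := C) hAc hQc hVc hQp hVp hP₀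
  have hPd : ∀ t, 0 ≤ t → HasEntryDeriv P _ (Ici 0) t := hP.2
  have hPc : ContinuousOn P (Ici 0) := fun t ht => (hPd t ht).continuousWithinAt
  have hKc : ContinuousOn (fun t => k t • (P t * Cᵀ * Q t)) (Ici 0) := by
    have h1 : Continuous fun p : ℝ × Matrix (StateIdx n) (StateIdx n) ℝ ×
        Matrix (OutIdx l) (OutIdx l) ℝ => p.1 • (p.2.1 * Cᵀ * p.2.2) :=
      continuous_fst.smul (((continuous_fst.comp continuous_snd).matrix_mul
        continuous_const).matrix_mul (continuous_snd.comp continuous_snd))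
    exact h1.comp_continuousOn (hk.prodMk (hPc.prodMk hQc))
  obtain ⟨p, hp, hPp⟩ := hP.exists_form_le (fun t ht => (hPpos t ht).1) hq (abs_nonneg cV)
    (fun t ht => le_form_of_posSemidef (hQq t ht))
    (fun t ht x => (form_le_of_posSemidef (hVV t ht) x).trans
      (mul_le_mul_of_nonneg_right (le_abs_self _) (dotProduct_self_nonneg' x))) hctrl
  obtain ⟨cC, hcC, hCC⟩ := exists_mulVec_dotProduct_le C
  obtain ⟨s, hs, hPs⟩ := (hP.inv hPpos).exists_form_le (v := |cQ| * cC)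
    (fun t ht => (hPpos t ht).inv.1) hv (by positivity)
    (fun t ht => le_form_of_posSemidef (hVv t ht))
    (fun t ht x => by
      have h1 := form_le_of_posSemidef (hQQ t ht) (C *ᵥ x)
      have h2 : cQ * ((C *ᵥ x) ⬝ᵥ (C *ᵥ x)) ≤ |cQ| * (cC * (x ⬝ᵥ x)) :=
        mul_le_mul (le_abs_self _) (hCC x) (dotProduct_self_nonneg' _) (abs_nonneg _)
      rw [← Matrix.mulVec_mulVec, ← Matrix.mulVec_mulVec, dotProduct_transpose_mulVec]
      linarith)
    (adjointControllable_neg_transpose_one (sq_nonneg B) fun t ht =>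
      stateMatrix_mulVec_dotProduct_le (hB t ht))
  refine ⟨P, hP, fun P' hP' => hP.unique hAc hQc hP', hPpos, fun x hx Xhat₀ => ?_, ?_⟩
  · have hX : ∀ t, 0 ≤ t → HasDerivWithinAt (fun t => augmentedState z α (x t)) _ (Ici 0) t :=
      fun t ht => hasDerivWithinAt_augmentedState hα (hx t ht)
    have hyc : ContinuousOn (fun t => measuredOutput z α (x t)) (Ici 0) := by
      simp only [measuredOutput_eq hα]
      exact (continuous_const.matrix_mulVec continuous_id).comp_continuousOn
        fun t ht => (hX t ht).continuousWithinAt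
    have huc : ContinuousOn (fun t => augmentedInput z α (u t)) (Ici 0) := by
      refine continuousOn_pi.2 fun i => ?_
      rcases i with i | i
      · exact (EuclideanSpace.proj (𝕜 := ℝ) i).continuous.comp_continuousOn hu
      · exact (continuousOn_finsetSum _ fun j _ =>
          continuousOn_const.mul (continuousOn_const.inner hu)).neg
    have hMc : ContinuousOn (fun t => stateMatrix (u t) - (k t • (P t * Cᵀ * Q t)) * C) (Ici 0) :=
      hAc.sub ((continuous_id.matrix_mul continuous_const).comp_continuousOn hKc)
    have hbc : ContinuousOn (fun t => augmentedInput z α (u t) +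
        (k t • (P t * Cᵀ * Q t)) *ᵥ measuredOutput z α (x t)) (Ici 0) :=
      huc.add ((continuous_fst.matrix_mulVec continuous_snd).comp_continuousOn (hKc.prodMk hyc))
    obtain ⟨Xhat, hX0, hXd⟩ := exists_affine_solution hMc hbc Xhat₀
    refine ⟨Xhat, hX0, fun t ht => (hXd t ht).congr_deriv ?_⟩
    rw [Matrix.sub_mulVec, Matrix.mulVec_sub, ← Matrix.mulVec_mulVec]
    abel
  · refine hP.globallyExponentiallyStable hPpos hQp hv hp hs
      (fun t ht => le_form_of_posSemidef (hVv t ht)) hk' hPp hPs ?_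
    rintro e ⟨x, Xhat, hx, hXhat, rfl⟩ t ht
    refine ((hasDerivWithinAt_augmentedState hα (hx t ht)).sub (hXhat t ht)).congr_deriv ?_
    simp only [measuredOutput_eq hα, ← hC]
    rw [← Matrix.mulVec_sub, Matrix.mulVec_sub (stateMatrix (u t))]
    abel

end ErrorDynamics

end RangeObserver

theorem mainTheorem4 {n l : ℕ} (z : Fin l → EuclideanSpace ℝ (Fin n)) (α : Fin l → ℝ)
    (hα : ∑ i, α i = 1)
    (u : ℝ → EuclideanSpace ℝ (Fin n)) (hu : ContinuousOn u (Set.Ici 0))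
    (hub : ∃ B : ℝ, ∀ t, 0 ≤ t → ‖u t‖ ≤ B)
    (k : ℝ → ℝ) (hk : ContinuousOn k (Set.Ici 0)) (hk' : ∀ t, 0 ≤ t → 1 / 2 ≤ k t)
    (Q : ℝ → Matrix (RangeObserver.OutIdx l) (RangeObserver.OutIdx l) ℝ)
    (hQ : RangeObserver.IsAdmissibleWeight Q)
    (V : ℝ → Matrix (RangeObserver.StateIdx n) (RangeObserver.StateIdx n) ℝ)
    (hV : RangeObserver.IsAdmissibleWeight V)
    (P₀ : Matrix (RangeObserver.StateIdx n) (RangeObserver.StateIdx n) ℝ) (hP₀ : P₀.PosDef) :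
    (UniformContinuousOn u (Set.Ici 0) →
      (∃ δ μ : ℝ, 0 < δ ∧ 0 < μ ∧ RangeObserver.PersistentlyExciting z α u δ μ) →
      RangeObserver.RiccatiObserverStabilizes z α u k Q V P₀) ∧
    ((RangeObserver.weightMatrix α * (RangeObserver.sourceMatrix z).transpose).rank = n →
      (∃ μ : ℝ, 0 < μ ∧ ∀ v : ℝ → EuclideanSpace ℝ (Fin n), ContinuousOn v (Set.Ici 0) →
        ∀ δ : ℝ, 0 < δ → RangeObserver.PersistentlyExciting z α v δ μ) ∧
      RangeObserver.RiccatiObserverStabilizes z α u k Q V P₀) ∧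
    ((∃ f : Fin (n + 1) → Fin l, AffineIndependent ℝ (fun i => z (f i))) →
      (RangeObserver.weightMatrix α * (RangeObserver.sourceMatrix z).transpose).rank = n) := by
  refine ⟨fun huc ⟨δ, μ, hδ, hμ, hPE⟩ => ?_, fun hrank => ⟨?_, ?_⟩, fun ⟨f, hf⟩ => ?_⟩
  · exact RangeObserver.riccatiObserverStabilizes_of_adjointControllable hα hu hub hk hk' hQ hV hP₀
      (RangeObserver.adjointControllable_of_persistentlyExciting z α huc hub hδ hμ hPE)
  · exact RangeObserver.exists_persistentlyExciting_of_rank_eq z α hrank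
  · exact RangeObserver.riccatiObserverStabilizes_of_adjointControllable hα hu hub hk hk' hQ hV hP₀
      (RangeObserver.adjointControllable_of_rank_eq z α hu hub hrank)
  · exact RangeObserver.rank_eq_of_affineIndependent z α hf
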